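/- **Conventions.** A *pointed proper metric space* $(X,x,d)$ is a metric space with a distinguished point all of whose closed balls $B^X(x,R)$ are compact. A *random point process* on $X$ is a random element $M$ (defined on some probability space) of the set of atomic measures $\sum_{i\in I}\delta_{x_i}$ on $X$ that are finite on compact sets, measurable for the $\sigma$-algebra generated by the maps $\mu\mapsto\mu(A)$, $A$ Borel. All point processes are assumed almost surely simple, with almost surely no atom at the distinguished point: $M(\{x\})=0$. *Rooted graphs.* $\mathfrak G_\bullet$ is the set of connected locally finite rooted simple graphs up to root-preserving isomorphism, and $\pi_n(\Gamma,r)$ is the rooted subgraph induced on the vertices at graph distance at most $n$ from $r$. The topology of $\mathfrak G_\bullet$ is the coarsest one that makes every $\pi_n$ continuous for the discrete topology on its target, i.e. $(\Gamma_N,r_N)\to(\Gamma,r)$ iff for every $n$, $\pi_n(\Gamma_N,r_N)=\pi_n(\Gamma,r)$ for all $N$ large enough. Random rooted graphs converge in the *local Benjamini–Schramm sense* if they are random variables for the Borel $\sigma$-algebra of $\mathfrak G_\bullet$ (up to null sets) and their laws converge weakly. *Geometric graphs.* For $L>0$, $\Gamma_{\mathrm{geom}}(X,x,d,M,L)\in\mathfrak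 G_\bullet$ is the connected component of $x$, rooted at $x$, in the graph with vertex set $\{x\}\cup\{\text{atoms of }M\}$ where distinct $y,z$ are joined iff $d(y,z)\le L$. *Regularity.* $(X,x,d,M)$ is *regular* if for every fixed $L>0$, almost surely, the map $l\mapsto\Gamma_{\mathrm{geom}}(X,x,d,M,l)\in\mathfrak G_\bullet$ is continuous at $l=L$. (It is sufficient for this that for every fixed $L>0$, almost surely, no two points of $\{x\}\cup\{\text{atoms of }M\}$ are at distance exactly $L$.) *Convergence of spaces.* For a homeomorphism $f$ between metric spaces let $\mathrm{dil}(f)=\sup_{y\ne z}\frac{d'(f(y),f(z))}{d(y,z)}\in[0,\infty]$, with the convention $\log\mathrm{dil}(f)=0$ for one-point spaces. The sequence $(X_N,x_N,d_N,M_N)_{N\in\mathbb N}$ converges to $(X,x,d,M)$ in the *random pointed Lipschitz sense* if for every $R>0$ there are $N_0$ and homeomorphisms $f_{N,R}:B^{X_N}(x_N,R)\to B^X(x,R)$, $N\ge N_0$, such that $$\lim_{N\to\infty}\Big(|\log\mathrm{dil}(f_{N,R})|+|\log\mathrm{dil}(f_{N,R}^{-1})|+d(f_{N,R}(x_N),x)+d_N(x_N,f_{N,R}^{-1}(x))\Big)=0,$$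 and such that for every continuous $\phi:X\to\mathbb R$ with support contained in $B^X(x,R)$, the random variables $\int_{B^{X_N}(x_N,R)}\phi\circ f_{N,R}\,\mathrm dM_N$ converge in law to $\int_{B^X(x,R)}\phi\,\mathrm dM$. **Theorem.** Let $(X_N,x_N,d_N,M_N)_{N\in\mathbb N}$ be a sequence of pointed proper metric spaces endowed with random point processes that converges in the random pointed Lipschitz sense to $(X,x,d,M)$, and assume that $(X,x,d,M)$ is regular. Then for every fixed $L>0$, the random rooted graphs $\Gamma_{\mathrm{geom}}(X_N,x_N,d_N,M_N,L)$ converge in the local Benjamini–Schramm sense to $\Gamma_{\mathrm{geom}}(X,x,d,M,L)$. -/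

import Mathlib

open MeasureTheory Filter Topology Metric
open scoped ENNReal

universe u v w

/-! ### Rooted graphs and the local topology -/

/-- A connected locally finite rooted simple graph. (Such a graph automatically has countably many
vertices.) -/
structure RootedGraph where
  V : Type u
  graph : SimpleGraph V
  root : V
  connected : graph.Connected
  finite_neighborSet : ∀ y, (graph.neighborSet y).Finite

/-- Two rooted graphs are isomorphic if there is a graph isomorphism between them that sends the
root to the root. -/
def RootedGraph.Isomorphic (A B : RootedGraph.{u}) : Prop :=
  ∃ φ : A.graph ≃g B.graph, φ A.root = B.root

instance RootedGraph.setoid : Setoid RootedGraph.{u} where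
  r := RootedGraph.Isomorphic
  iseqv :=
    { refl := fun _ => ⟨RelIso.refl _, rfl⟩
      symm := by
        rintro A B ⟨φ, h⟩
        exact ⟨φ.symm, by rw [← h]; exact φ.symm_apply_apply _⟩
      trans := by
        rintro A B C ⟨φ, h⟩ ⟨ψ, k⟩
        exact ⟨φ.trans ψ, by rw [← k, ← h]; rfl⟩ }

/-- The set of connected locally finite rooted graphs, up to rooted isomorphism. -/
def RootedGraphClass : Type (u + 1) := Quotient RootedGraph.setoid.{u}

theorem SimpleGraph.Iso.dist_apply {V : Type v} {W : Type w} {G : SimpleGraph V}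
    {H : SimpleGraph W} (φ : G ≃g H) (hG : G.Connected) (x y : V) :
    H.dist (φ x) (φ y) = G.dist x y := by
  have hH : H.Connected := (SimpleGraph.Iso.connected_iff φ).1 hG
  apply le_antisymm
  · obtain ⟨p, hp⟩ := hG.exists_walk_length_eq_dist x y
    rw [← hp, ← SimpleGraph.Walk.length_map φ.toHom p]
    exact SimpleGraph.dist_le (p.map φ.toHom)
  · obtain ⟨p, hp⟩ := hH.exists_walk_length_eq_dist (φ x) (φ y)
    have h := SimpleGraph.dist_le (p.map φ.symm.toHom)
    rw [SimpleGraph.Walk.length_map, hp] at h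
    have e1 : φ.symm.toHom (φ x) = x := φ.symm_apply_apply x
    have e2 : φ.symm.toHom (φ y) = y := φ.symm_apply_apply y
    rwa [e1, e2] at h

/-- The rooted subgraph induced on the vertices at graph distance at most `n` from the root. -/
def RootedGraph.ball (n : ℕ) (A : RootedGraph.{u}) : RootedGraph.{u} where
  V := {y : A.V | A.graph.dist A.root y ≤ n}
  graph := A.graph.induce {y : A.V | A.graph.dist A.root y ≤ n}
  root := ⟨A.root, by simp⟩
  connected := by
    classical
    refine A.graph.induce_connected_of_patches A.root (by simp) ?_
    intro y hy
    obtain ⟨p, hp⟩ := A.connected.exists_walk_length_eq_dist A.root y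
    refine ⟨{z | z ∈ p.support}, ?_, p.start_mem_support, p.end_mem_support,
      p.connected_induce_support.preconnected _ _⟩
    intro z hz
    have h1 := SimpleGraph.dist_le (p.takeUntil z hz)
    have h2 := p.length_takeUntil_le_length hz
    have h3 : A.graph.dist A.root y ≤ n := hy
    show A.graph.dist A.root z ≤ n
    omega
  finite_neighborSet := by
    intro y
    refine Set.Finite.of_finite_image (f := Subtype.val) ?_ Subtype.val_injective.injOn
    refine (A.finite_neighborSet y.1).subset ?_
    rintro _ ⟨z, hz, rfl⟩
    exact hz

/-- The connected component of `r` in a locally finite graph, rooted at `r`. -/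
def RootedGraph.component {V : Type u} (G : SimpleGraph V) (hG : ∀ y, (G.neighborSet y).Finite)
    (r : V) : RootedGraph.{u} where
  V := G.connectedComponentMk r
  graph := (G.connectedComponentMk r).toSimpleGraph
  root := ⟨r, SimpleGraph.ConnectedComponent.connectedComponentMk_mem⟩
  connected := SimpleGraph.ConnectedComponent.connected_toSimpleGraph _
  finite_neighborSet := by
    intro y
    refine Set.Finite.of_finite_image (f := Subtype.val) ?_ Subtype.val_injective.injOn
    refine (hG y.1).subset ?_
    rintro _ ⟨z, hz, rfl⟩
    exact hz

/-- The truncation `π_n` on isomorphism classes of rooted graphs. -/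
def RootedGraphClass.truncate (n : ℕ) : RootedGraphClass.{u} → RootedGraphClass.{u} :=
  Quotient.map (RootedGraph.ball n) (by
    rintro A B ⟨φ, h⟩
    refine ⟨⟨φ.toEquiv.subtypeEquiv fun y => ?_, ?_⟩, Subtype.ext h⟩
    · show A.graph.dist A.root y ≤ n ↔ B.graph.dist B.root (φ y) ≤ n
      rw [← h, φ.dist_apply A.connected]
    · intro y z
      exact φ.map_rel_iff)

/-- The local topology on rooted graphs: the projective limit topology associated with the
truncations `π_n`, the targets being discrete. -/
instance : TopologicalSpace RootedGraphClass.{u} :=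
  ⨅ n : ℕ, TopologicalSpace.induced (RootedGraphClass.truncate n) ⊥

instance : MeasurableSpace RootedGraphClass.{u} := borel _

instance : BorelSpace RootedGraphClass.{u} := ⟨rfl⟩

/-! ### Atomic measures, point processes and geometric graphs -/

/-- A measure is atomic if it is a sum of Dirac masses that is finite on compact sets. -/
def IsAtomicMeasure {X : Type u} [TopologicalSpace X] [MeasurableSpace X] (μ : Measure X) : Prop :=
  (∃ (ι : Type) (_ : Countable ι) (p : ι → X), μ = Measure.sum fun i => Measure.dirac (p i)) ∧
    ∀ K : Set X, IsCompact K → μ K < ∞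

/-- The space of atomic measures, with the σ-algebra generated by the evaluations `μ ↦ μ A`
on measurable sets `A`. -/
abbrev AtomicMeasure (X : Type u) [TopologicalSpace X] [MeasurableSpace X] : Type u :=
  {μ : Measure X // IsAtomicMeasure μ}

/-- `M` is a random point process which is almost surely simple and almost surely has no atom at
the distinguished point `x`. -/
structure IsSimplePointProcess {X : Type u} [TopologicalSpace X] [MeasurableSpace X]
    {Ω : Type v} [MeasurableSpace Ω] (P : Measure Ω) (x : X) (M : Ω → AtomicMeasure X) : Prop where
  measurable : Measurable M
  simple : ∀ᵐ ω ∂P, ∀ y : X, (M ω : Measure X) {y} ≤ 1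
  root_notMem : ∀ᵐ ω ∂P, (M ω : Measure X) {x} = 0

section

variable {X : Type u} [MetricSpace X] [MeasurableSpace X]

/-- The distinguished point, together with the atoms of the measure. -/
def geomVertices (x : X) (μ : AtomicMeasure X) : Set X :=
  {y | y = x ∨ (μ : Measure X) {y} ≠ 0}

theorem self_mem_geomVertices (x : X) (μ : AtomicMeasure X) : x ∈ geomVertices x μ :=
  Or.inl rfl

/-- The graph on the distinguished point and the atoms, in which two distinct points are joined
when they are at distance at most `L`. -/
def fullGeomGraph (x : X) (μ : AtomicMeasure X) (L : ℝ) : SimpleGraph (geomVertices x μ) where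
  Adj y z := y ≠ z ∧ dist (y : X) (z : X) ≤ L
  symm := ⟨fun _ _ h => ⟨h.1.symm, by rw [dist_comm]; exact h.2⟩⟩
  loopless := ⟨fun _ h => h.1 rfl⟩

theorem IsAtomicMeasure.finite_atoms [BorelSpace X] {μ : Measure X} (hμ : IsAtomicMeasure μ)
    {K : Set X} (hK : IsCompact K) : {y ∈ K | μ {y} ≠ 0}.Finite := by
  obtain ⟨⟨ι, hι, p, rfl⟩, hfin⟩ := hμ
  have h := hfin K hK
  rw [Measure.sum_apply _ hK.measurableSet] at h
  have h1 := ENNReal.finite_const_le_of_tsum_ne_top h.ne one_ne_zero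
  refine (h1.image p).subset ?_
  rintro y ⟨hyK, hy⟩
  rw [Measure.sum_apply _ (measurableSet_singleton y)] at hy
  obtain ⟨i, hi⟩ : ∃ i, (Measure.dirac (p i)) {y} ≠ 0 := by
    by_contra hcon
    push Not at hcon
    exact hy (by simp [hcon])
  have hpy : p i = y := by
    by_contra hne
    apply hi
    rw [Measure.dirac_apply' _ (measurableSet_singleton y)]
    simp [hne]
  refine ⟨i, ?_, hpy⟩
  show 1 ≤ (Measure.dirac (p i)) K
  rw [Measure.dirac_apply' _ hK.measurableSet]
  simp [hpy, hyK]

theorem fullGeomGraph_finite_neighborSet [ProperSpace X] [BorelSpace X] (x : X)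
    (μ : AtomicMeasure X) (L : ℝ) (y : geomVertices x μ) :
    ((fullGeomGraph x μ L).neighborSet y).Finite := by
  refine Set.Finite.of_finite_image (f := Subtype.val) ?_ Subtype.val_injective.injOn
  refine ((μ.2.finite_atoms (isCompact_closedBall (y : X) L)).union
    (Set.finite_singleton x)).subset ?_
  rintro _ ⟨z, hz, rfl⟩
  rcases z.2 with h | h
  · exact Or.inr h
  · exact Or.inl ⟨by rw [mem_closedBall, dist_comm]; exact hz.2, h⟩

variable [ProperSpace X] [BorelSpace X]

/-- The geometric graph at level `L`, rooted at the distinguished point `x`; only the connected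
component of `x` is kept. -/
def geomRootedGraph (x : X) (μ : AtomicMeasure X) (L : ℝ) : RootedGraph.{u} :=
  RootedGraph.component (fullGeomGraph x μ L) (fullGeomGraph_finite_neighborSet x μ L)
    ⟨x, self_mem_geomVertices x μ⟩

/-- The isomorphism class of the rooted geometric graph. -/
def geomGraph (x : X) (μ : AtomicMeasure X) (L : ℝ) : RootedGraphClass.{u} :=
  Quotient.mk _ (geomRootedGraph x μ L)

/-- A pointed proper metric space with a point process is regular if, for every fixed `L > 0`, the
map `l ↦ Γ_geom(l)` is almost surely continuous at `l = L`. (Since `L > 0`, only values `l > 0`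
matter.) -/
def IsRegularPointProcess {Ω : Type v} [MeasurableSpace Ω] (P : Measure Ω) (x : X)
    (M : Ω → AtomicMeasure X) : Prop :=
  ∀ L : ℝ, 0 < L → ∀ᵐ ω ∂P, ContinuousAt (fun l : ℝ => geomGraph x (M ω) l) L

end

/-! ### Random pointed Lipschitz convergence -/

/-- The dilation constant `sup_{y ≠ z} d(f y, f z) / d(y, z)`, with values in `[0, ∞]`. -/
noncomputable def dilation {Y : Type v} {Z : Type w} [MetricSpace Y] [MetricSpace Z]
    (f : Y → Z) : ℝ≥0∞ :=
  ⨆ (y : Y) (z : Y) (_ : y ≠ z), edist (f y) (f z) / edist y z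

open Classical in
/-- `|log dil(f)|`, with values in `[0, ∞]`. When `Y` has at most one point the supremum defining
`dil(f)` is empty, and the value is `0` (homeomorphisms between one-point spaces are
isometries). -/
noncomputable def absLogDilation {Y : Type v} {Z : Type w} [MetricSpace Y] [MetricSpace Z]
    (f : Y → Z) : ℝ≥0∞ :=
  if Subsingleton Y then 0 else (ENNReal.log (dilation f)).abs

/-- The quantity `|log dil(f)| + |log dil(f⁻¹)| + d(f y, z) + d(y, f⁻¹ z)`. -/
noncomputable def pointedDistortion {Y : Type v} {Z : Type w} [MetricSpace Y] [MetricSpace Z]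
    (f : Y ≃ₜ Z) (y : Y) (z : Z) : ℝ≥0∞ :=
  absLogDilation f + absLogDilation f.symm + edist (f y) z + edist y (f.symm z)

/-- The center of a closed ball of positive radius, as a point of this ball. -/
def ballCenter {X : Type u} [MetricSpace X] (x : X) {R : ℝ} (hR : 0 < R) : closedBall x R :=
  ⟨x, mem_closedBall_self hR.le⟩

/-- Convergence in the random pointed Lipschitz sense of the pointed metric spaces
`(X N, x N)` with point processes `M N` towards `(X', x')` with point process `M'`. The integral of
a function against an atomic measure on a closed ball is the sum of its values over the atoms in
that ball. -/
def RandomPointedLipschitzTendsto {X : ℕ → Type u} [∀ N, MetricSpace (X N)]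
    [∀ N, MeasurableSpace (X N)] (x : ∀ N, X N)
    {Ω : ℕ → Type v} [∀ N, MeasurableSpace (Ω N)] (P : ∀ N, Measure (Ω N))
    [∀ N, IsProbabilityMeasure (P N)] (M : ∀ N, Ω N → AtomicMeasure (X N))
    {X' : Type u} [MetricSpace X'] [MeasurableSpace X'] (x' : X')
    {Ω' : Type w} [MeasurableSpace Ω'] (P' : Measure Ω')
    [IsProbabilityMeasure P'] (M' : Ω' → AtomicMeasure X') : Prop :=
  ∀ (R : ℝ) (hR : 0 < R), ∃ (N₀ : ℕ)
    (f : ∀ N : Set.Ici N₀, closedBall (x N) R ≃ₜ closedBall x' R),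
    Tendsto (fun N : Set.Ici N₀ => pointedDistortion (f N) (ballCenter (x N) hR) (ballCenter x' hR))
      atTop (𝓝 0) ∧
    ∀ φ : X' → ℝ, Continuous φ → tsupport φ ⊆ closedBall x' R →
      TendstoInDistribution
        (fun (N : Set.Ici N₀) (ω : Ω N) =>
          ∫ y : closedBall (x N) R, φ (f N y) ∂((M N ω : Measure (X N)).comap Subtype.val))
        atTop
        (fun ω => ∫ y in closedBall x' R, φ y ∂(M' ω : Measure X'))
        (fun N : Set.Ici N₀ => P N) P'

/-! ### Balls in graphs -/

/-! By the portmanteau theorem it suffices that P'(Γ ∈ O) ≤ liminf P_N(Γ_N ∈ O) for every open O. An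
open set is the increasing union over n of the unions of level-n cylinders it contains, so only
truncations π_n matter.

Deterministic core (`exists_forall_truncate_geomGraph_eq`): for a simple configuration with no atom
at x, and no distance equal to L between a vertex of the n-ball and a vertex near x, π_n is stable.
It is unchanged for any configuration carried over by a near-isometry of balls, provided finitely
many integrals of test functions nearly agree. Bump functions produce an atom near each atom of the
limit, a plateau function bounds the number of atoms from above, and counting turns this into a
bijection. The bijection respects adjacency because the finitely many relevant distances stay away
from L. Regularity supplies this genericity almost surely (`dist_ne_of_continuousAt_geomGraph`).

Probabilistic core (`measure_le_liminf_of_locally_determined`): linear combinations of test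
functions are test functions, so Cramér-Wold gives joint convergence in law of finitely many
integrals. Portmanteau in finite dimension then yields the liminf bound.

Measurability of Γ at a possibly non-generic level L follows by approximating L from the right by
levels that are generic for the given configuration. -/

namespace SimpleGraph

variable {V : Type v} {W : Type w}

/-- The vertices joined to `r` by a walk of length at most `n`. -/
def reachWithin (G : SimpleGraph V) (r : V) : ℕ → Set V
  | 0 => {r}
  | n + 1 => G.reachWithin r n ∪ {y | ∃ z ∈ G.reachWithin r n, G.Adj z y}

theorem reachWithin_mono (G : SimpleGraph V) (r : V) : Monotone (G.reachWithin r) :=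
  monotone_nat_of_le_succ fun _ => Set.subset_union_left

theorem self_mem_reachWithin (G : SimpleGraph V) (r : V) (n : ℕ) : r ∈ G.reachWithin r n :=
  G.reachWithin_mono r (Nat.zero_le n) rfl

theorem mem_reachWithin_iff_exists_walk (G : SimpleGraph V) (r : V) (n : ℕ) (y : V) :
    y ∈ G.reachWithin r n ↔ ∃ p : G.Walk r y, p.length ≤ n := by
  induction n generalizing y with
  | zero =>
    constructor
    · rintro rfl
      exact ⟨.nil, le_rfl⟩
    · rintro ⟨p, hp⟩
      exact (Walk.eq_of_length_eq_zero (Nat.le_zero.1 hp)).symm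
  | succ n ih =>
    constructor
    · rintro (h | ⟨z, hz, hzy⟩)
      · obtain ⟨p, hp⟩ := (ih y).1 h
        exact ⟨p, by omega⟩
      · obtain ⟨p, hp⟩ := (ih z).1 hz
        exact ⟨p.concat hzy, by rw [Walk.length_concat]; omega⟩
    · rintro ⟨p, hp⟩
      -- `reachWithin` grows at the far end of a walk, whereas walks decompose at their start; hence
      -- the reversal.
      rw [← Walk.length_reverse] at hp
      cases hq : p.reverse with
      | nil => exact self_mem_reachWithin G _ _
      | cons h q =>
        rw [hq, Walk.length_cons] at hp
        refine Or.inr ⟨_, (ih _).2 ⟨q.reverse, ?_⟩, h.symm⟩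
        rw [Walk.length_reverse]
        omega

/-- Connectedness is essential: `dist` has the default value 0 between different components, whereas
`reachWithin` gives the right ball in any graph. -/
theorem Connected.dist_le_iff_mem_reachWithin {G : SimpleGraph V} (hG : G.Connected) (r y : V)
    (n : ℕ) : G.dist r y ≤ n ↔ y ∈ G.reachWithin r n := by
  rw [mem_reachWithin_iff_exists_walk]
  constructor
  · intro h
    obtain ⟨p, hp⟩ := hG.exists_walk_length_eq_dist r y
    exact ⟨p, hp.trans_le h⟩
  · rintro ⟨p, hp⟩
    exact (dist_le p).trans hp

theorem Reachable.exists_mem_reachWithin {G : SimpleGraph V} {r y : V} (h : G.Reachable r y) :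
    ∃ n, y ∈ G.reachWithin r n := by
  obtain ⟨p⟩ := h
  exact ⟨p.length, (G.mem_reachWithin_iff_exists_walk r _ y).2 ⟨p, le_rfl⟩⟩

theorem reachable_of_mem_reachWithin {G : SimpleGraph V} {r y : V} {n : ℕ}
    (h : y ∈ G.reachWithin r n) : G.Reachable r y :=
  ((G.mem_reachWithin_iff_exists_walk r n y).1 h).choose.reachable

theorem finite_reachWithin {G : SimpleGraph V} (hG : ∀ y, (G.neighborSet y).Finite) (r : V)
    (n : ℕ) : (G.reachWithin r n).Finite := by
  induction n with
  | zero => exact Set.finite_singleton r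
  | succ n ih =>
    refine ih.union ((ih.biUnion fun z _ => hG z).subset ?_)
    rintro y ⟨z, hz, hzy⟩
    exact Set.mem_biUnion hz hzy

/-- The balls of radius `n` around `r` in `G` and around `s` in `H` are isomorphic as rooted
graphs. -/
def SameBall (n : ℕ) (G : SimpleGraph V) (r : V) (H : SimpleGraph W) (s : W) : Prop :=
  ∃ φ : G.induce (G.reachWithin r n) ≃g H.induce (H.reachWithin s n),
    φ ⟨r, G.self_mem_reachWithin r n⟩ = ⟨s, H.self_mem_reachWithin s n⟩

theorem SameBall.symm {n : ℕ} {G : SimpleGraph V} {r : V} {H : SimpleGraph W} {s : W}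
    (h : SameBall n G r H s) : SameBall n H s G r := by
  obtain ⟨φ, hφ⟩ := h
  exact ⟨φ.symm, by rw [← hφ]; exact φ.symm_apply_apply _⟩

theorem SameBall.trans {n : ℕ} {U : Type u} {G : SimpleGraph V} {r : V} {H : SimpleGraph W} {s : W}
    {K : SimpleGraph U} {t : U} (h : SameBall n G r H s) (k : SameBall n H s K t) :
    SameBall n G r K t := by
  obtain ⟨φ, hφ⟩ := h
  obtain ⟨ψ, hψ⟩ := k
  exact ⟨φ.trans ψ, by rw [← hψ, ← hφ]; rfl⟩

/-- Induction on the radius k. Adjacency is compared only when the first vertex lies in the n-ball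
of G; this is the form regularity can provide, since it says nothing about pairs outside the
component of the root. -/
theorem mem_reachWithin_iff_of_equiv {n : ℕ} {G : SimpleGraph V} {r : V} {H : SimpleGraph W} {s : W}
    {S : Set V} {T : Set W} (e : S ≃ T) (hr : r ∈ S) (hs : (e ⟨r, hr⟩ : W) = s)
    (hS : G.reachWithin r n ⊆ S) (hT : H.reachWithin s n ⊆ T)
    (hadj : ∀ y z : S, (y : V) ∈ G.reachWithin r n → (G.Adj y z ↔ H.Adj (e y) (e z)))
    {k : ℕ} (hk : k ≤ n) (y : S) : (y : V) ∈ G.reachWithin r k ↔ (e y : W) ∈ H.reachWithin s k := by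
  induction k generalizing y with
  | zero =>
    show (y : V) = r ↔ (e y : W) = s
    rw [← hs, ← Subtype.ext_iff, e.apply_eq_iff_eq, Subtype.ext_iff]
  | succ k ih =>
    have ih := ih (by omega)
    constructor
    · rintro (h | ⟨z, hz, hzy⟩)
      · exact Or.inl ((ih y).1 h)
      · have hzn := G.reachWithin_mono r (by omega : k ≤ n) hz
        exact Or.inr ⟨_, (ih ⟨z, hS hzn⟩).1 hz, (hadj ⟨z, hS hzn⟩ y hzn).1 hzy⟩
    · rintro (h | ⟨z, hz, hzy⟩)
      · exact Or.inl ((ih y).2 h)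
      · obtain ⟨z, rfl⟩ : ∃ z' : S, (e z' : W) = z :=
          ⟨e.symm ⟨z, hT (H.reachWithin_mono s (by omega : k ≤ n) hz)⟩, by simp⟩
        have hz' := (ih z).2 hz
        exact Or.inr ⟨z, hz', (hadj z y (G.reachWithin_mono r (by omega : k ≤ n) hz')).2 hzy⟩

theorem sameBall_of_equiv {n : ℕ} {G : SimpleGraph V} {r : V} {H : SimpleGraph W} {s : W}
    {S : Set V} {T : Set W} (e : S ≃ T) (hr : r ∈ S) (hs : (e ⟨r, hr⟩ : W) = s)
    (hS : G.reachWithin r n ⊆ S) (hT : H.reachWithin s n ⊆ T)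
    (hadj : ∀ y z : S, (y : V) ∈ G.reachWithin r n → (G.Adj y z ↔ H.Adj (e y) (e z))) :
    SameBall n G r H s := by
  have key := fun y => mem_reachWithin_iff_of_equiv e hr hs hS hT hadj le_rfl y
  refine ⟨⟨⟨fun y => ⟨e ⟨y, hS y.2⟩, (key ⟨y, hS y.2⟩).1 y.2⟩,
    fun z => ⟨e.symm ⟨z, hT z.2⟩, (key _).2 (by simp [z.2])⟩, fun y => by simp,
    fun z => by simp⟩, ?_⟩, Subtype.ext hs⟩
  intro y z
  exact (hadj ⟨y, hS y.2⟩ ⟨z, hS z.2⟩ y.2).symm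

theorem SameBall.of_le {m n : ℕ} (hmn : m ≤ n) {G : SimpleGraph V} {r : V} {H : SimpleGraph W}
    {s : W} (h : SameBall n G r H s) : SameBall m G r H s := by
  obtain ⟨φ, hφ⟩ := h
  exact sameBall_of_equiv φ.toEquiv (G.self_mem_reachWithin r n) (congrArg Subtype.val hφ)
    (G.reachWithin_mono r hmn) (H.reachWithin_mono s hmn) fun y z _ => φ.map_rel_iff.symm

/-- A ball around r never leaves the component of r. Comparisons of truncations can therefore be
made in the full geometric graphs. -/
theorem sameBall_component {G : SimpleGraph V} (hG : ∀ y, (G.neighborSet y).Finite) (r : V)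
    (n : ℕ) :
    SameBall n G r (RootedGraph.component G hG r).graph (RootedGraph.component G hG r).root := by
  have hsub : G.reachWithin r n ⊆ {y | y ∈ G.connectedComponentMk r} := fun y hy =>
    ConnectedComponent.sound (reachable_of_mem_reachWithin hy).symm
  exact sameBall_of_equiv (Equiv.Set.univ _).symm (hsub (G.self_mem_reachWithin r n)) rfl hsub
    (Set.subset_univ _) fun y z _ => Iff.rfl

end SimpleGraph

open SimpleGraph (SameBall sameBall_component sameBall_of_equiv)

/-! ### Truncations and neighbourhoods in terms of isomorphic balls -/

theorem SimpleGraph.exists_rooted_iso_congr {V : Type v} {W : Type w} {G : SimpleGraph V}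
    {H : SimpleGraph W} {r : V} {s : W} {S S' : Set V} {T T' : Set W} (hS : S = S') (hT : T = T')
    (hr : r ∈ S) (hr' : r ∈ S') (hs : s ∈ T) (hs' : s ∈ T') :
    (∃ φ : G.induce S ≃g H.induce T, φ ⟨r, hr⟩ = ⟨s, hs⟩) ↔
      ∃ φ : G.induce S' ≃g H.induce T', φ ⟨r, hr'⟩ = ⟨s, hs'⟩ := by
  subst hS hT
  rfl

theorem RootedGraph.ball_isomorphic_iff_sameBall (n : ℕ) (A B : RootedGraph.{u}) :
    (A.ball n).Isomorphic (B.ball n) ↔ SameBall n A.graph A.root B.graph B.root := by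
  have h : ∀ A : RootedGraph.{u}, {y : A.V | A.graph.dist A.root y ≤ n} =
      A.graph.reachWithin A.root n := fun A =>
    Set.ext fun y => A.connected.dist_le_iff_mem_reachWithin A.root y n
  exact SimpleGraph.exists_rooted_iso_congr (h A) (h B) _ _ _ _

theorem RootedGraphClass.truncate_mk_eq_iff (n : ℕ) (A B : RootedGraph.{u}) :
    truncate n (Quotient.mk _ A) = truncate n (Quotient.mk _ B) ↔
      SameBall n A.graph A.root B.graph B.root := by
  rw [← RootedGraph.ball_isomorphic_iff_sameBall]
  exact Quotient.eq

theorem RootedGraphClass.truncate_component_eq_iff (n : ℕ) {V W : Type u} {G : SimpleGraph V}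
    (hG : ∀ y, (G.neighborSet y).Finite) (r : V) {H : SimpleGraph W}
    (hH : ∀ y, (H.neighborSet y).Finite) (s : W) :
    truncate n (Quotient.mk _ (RootedGraph.component G hG r)) =
      truncate n (Quotient.mk _ (RootedGraph.component H hH s)) ↔ SameBall n G r H s := by
  rw [truncate_mk_eq_iff]
  exact ⟨fun h => ((sameBall_component hG r n).trans h).trans (sameBall_component hH s n).symm,
    fun h => ((sameBall_component hG r n).symm.trans h).trans (sameBall_component hH s n)⟩

theorem RootedGraphClass.truncate_eq_of_le {m n : ℕ} (hmn : m ≤ n) {g h : RootedGraphClass.{u}}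
    (H : truncate n g = truncate n h) : truncate m g = truncate m h := by
  induction g using Quotient.inductionOn with | _ A
  induction h using Quotient.inductionOn with | _ B
  rw [truncate_mk_eq_iff] at H ⊢
  exact H.of_le hmn

theorem RootedGraphClass.nhds_hasBasis (g : RootedGraphClass.{u}) :
    (𝓝 g).HasBasis (fun _ : ℕ => True) fun n => {h | truncate n h = truncate n g} := by
  have h : 𝓝 g = ⨅ n, 𝓟 {h | truncate n h = truncate n g} := by
    rw [nhds_iInf]
    refine iInf_congr fun n => ?_
    -- Local discrete topology for the target of `truncate n`.
    let _ : TopologicalSpace RootedGraphClass.{u} := ⊥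
    have _ : DiscreteTopology RootedGraphClass.{u} := ⟨rfl⟩
    rw [nhds_induced, nhds_discrete, comap_pure]
    rfl
  rw [h]
  refine hasBasis_iInf_principal (directed_of_isDirected_le fun m n hmn h H => ?_)
  exact truncate_eq_of_le hmn H

/-! ### Levels of geometric graphs -/

/-- An isomorphism from the ball of G to that of its subgraph H injects the finite set of edges of
the G-ball into itself. It is then onto, so every edge is the image of an edge and hence lies in H.
-/
theorem SimpleGraph.SameBall.adj_of_le {V : Type u} {G H : SimpleGraph V} (hHG : H ≤ G)
    (hG : ∀ y, (G.neighborSet y).Finite) {r : V} {n : ℕ} (h : SameBall n G r H r) {y z : V}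
    (hy : y ∈ G.reachWithin r n) (hz : z ∈ G.reachWithin r n) (hyz : G.Adj y z) : H.Adj y z := by
  obtain ⟨φ, -⟩ := h
  have hsub : H.reachWithin r n ⊆ G.reachWithin r n := by
    intro y
    simp only [SimpleGraph.mem_reachWithin_iff_exists_walk]
    rintro ⟨p, hp⟩
    exact ⟨p.mapLe hHG, by simpa using hp⟩
  have := (G.finite_reachWithin hG r n).to_subtype
  let ψ : {p : G.reachWithin r n × G.reachWithin r n // G.Adj p.1 p.2} →
      {p : G.reachWithin r n × G.reachWithin r n // G.Adj p.1 p.2} := fun p =>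
    ⟨(⟨φ p.1.1, hsub (φ p.1.1).2⟩, ⟨φ p.1.2, hsub (φ p.1.2).2⟩),
      hHG (φ.map_rel_iff.2 p.2 : (H.induce _).Adj (φ p.1.1) (φ p.1.2))⟩
  have hψ : Function.Injective ψ := by
    rintro ⟨⟨a, b⟩, h⟩ ⟨⟨c, d⟩, h'⟩ heq
    have h1 : (φ a : V) = φ c := congrArg (fun p => (p.1.1 : V)) heq
    have h2 : (φ b : V) = φ d := congrArg (fun p => (p.1.2 : V)) heq
    have h1 := φ.injective (Subtype.ext h1)
    have h2 := φ.injective (Subtype.ext h2)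
    subst h1 h2
    rfl
  obtain ⟨⟨⟨a, b⟩, hab⟩, h⟩ := Finite.surjective_of_injective hψ ⟨(⟨y, hy⟩, ⟨z, hz⟩), hyz⟩
  have h1 : (φ a : V) = y := congrArg (fun p => (p.1.1 : V)) h
  have h2 : (φ b : V) = z := congrArg (fun p => (p.1.2 : V)) h
  rw [← h1, ← h2]
  exact (φ.map_rel_iff.2 hab : (H.induce _).Adj (φ a) (φ b))

section

variable {X : Type u} [MetricSpace X] [MeasurableSpace X]

theorem dist_le_of_mem_reachWithin {x : X} {μ : AtomicMeasure X} {L : ℝ} {n : ℕ}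
    {y : geomVertices x μ}
    (hy : y ∈ (fullGeomGraph x μ L).reachWithin ⟨x, self_mem_geomVertices x μ⟩ n) (hL : 0 ≤ L) :
    dist (y : X) x ≤ n * L := by
  induction n generalizing y with
  | zero =>
    rw [show y = _ from hy]
    simp
  | succ n ih =>
    push_cast
    rcases hy with hy | ⟨z, hz, hzy⟩
    · have := ih hy
      linarith
    · have h1 := ih hz
      have h2 : dist (z : X) (y : X) ≤ L := hzy.2
      have h3 := dist_triangle_left (y : X) x z
      linarith

variable [ProperSpace X] [BorelSpace X]

theorem truncate_geomGraph_eq_iff {Y : Type u} [MetricSpace Y] [MeasurableSpace Y]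
    [ProperSpace Y] [BorelSpace Y] (n : ℕ) (x : X) (μ : AtomicMeasure X) (L : ℝ) (y : Y)
    (ν : AtomicMeasure Y) (l : ℝ) :
    RootedGraphClass.truncate n (geomGraph x μ L) = RootedGraphClass.truncate n (geomGraph y ν l) ↔
      SameBall n (fullGeomGraph x μ L) ⟨x, self_mem_geomVertices x μ⟩ (fullGeomGraph y ν l)
        ⟨y, self_mem_geomVertices y ν⟩ :=
  RootedGraphClass.truncate_component_eq_iff n _ _ _ _

/-- A pair at distance exactly L is an edge at level L but at no level l < L. Continuity from the
left makes the balls at l and L isomorphic, and a finite graph is not isomorphic to a subgraph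
missing an edge. -/
theorem dist_ne_of_continuousAt_geomGraph {x : X} {μ : AtomicMeasure X} {L : ℝ} (hL : 0 < L)
    (h : ContinuousAt (fun l : ℝ => geomGraph x μ l) L) {y z : geomVertices x μ}
    (hy : (fullGeomGraph x μ L).Reachable ⟨x, self_mem_geomVertices x μ⟩ y) :
    dist (y : X) (z : X) ≠ L := by
  intro hyz
  obtain ⟨n, hn⟩ := hy.exists_mem_reachWithin
  have hne : y ≠ z := by
    rintro rfl
    rw [dist_self] at hyz
    exact hL.ne hyz
  have hadj : (fullGeomGraph x μ L).Adj y z := ⟨hne, hyz.le⟩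
  -- Radius n + 1, so that the neighbour z of y is also in the ball.
  have hev := h.eventually ((RootedGraphClass.nhds_hasBasis _).mem_of_mem (i := n + 1) trivial)
  obtain ⟨l, hl, hlL⟩ := ((hev.filter_mono nhdsWithin_le_nhds).and
    (self_mem_nhdsWithin : Set.Iio L ∈ 𝓝[<] L)).exists
  have hl := (truncate_geomGraph_eq_iff _ _ _ _ _ _ _).1 hl.symm
  have hle : fullGeomGraph x μ l ≤ fullGeomGraph x μ L := fun a b hab =>
    ⟨hab.1, hab.2.trans (le_of_lt hlL)⟩
  have := hl.adj_of_le hle (fullGeomGraph_finite_neighborSet x μ L) (Or.inl hn)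
    (Or.inr ⟨y, hn, hadj⟩) hadj
  exact absurd (this.2.trans_lt hlL) (by rw [hyz]; exact lt_irrefl L)

theorem finite_geomVertices_inter_closedBall (x : X) (μ : AtomicMeasure X) (s : ℝ) :
    {y : geomVertices x μ | dist (y : X) x ≤ s}.Finite := by
  refine Set.Finite.of_finite_image (f := Subtype.val) ?_ Subtype.val_injective.injOn
  refine ((μ.2.finite_atoms (isCompact_closedBall x s)).union
    (Set.finite_singleton x)).subset ?_
  rintro _ ⟨z, hz, rfl⟩
  rcases z.2 with h | h
  · exact Or.inr h
  · exact Or.inl ⟨hz, h⟩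

/-- Only finitely many distances occur near x, so for l slightly above L none lies in (L, l].
Adjacency is defined by ≤, so the graph is right-continuous in the level, and these l are generic
even when L is not. -/
theorem eventually_truncate_geomGraph_eq (x : X) (μ : AtomicMeasure X) {L : ℝ} (hL : 0 ≤ L)
    (n : ℕ) {s : ℝ} (hs : n * L < s) :
    ∀ᶠ l in 𝓝[>] L,
      RootedGraphClass.truncate n (geomGraph x μ l) = RootedGraphClass.truncate n (geomGraph x μ L) ∧
      ∀ y z : geomVertices x μ, dist (y : X) x ≤ s → dist (z : X) x ≤ s →
        dist (y : X) (z : X) ≠ l := by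
  have hfin := finite_geomVertices_inter_closedBall x μ s
  have h1 : ∀ᶠ l in 𝓝[>] L, ∀ p ∈ {y : geomVertices x μ | dist (y : X) x ≤ s} ×ˢ
      {y : geomVertices x μ | dist (y : X) x ≤ s},
      dist (p.1 : X) (p.2 : X) ≤ L ∨ l < dist (p.1 : X) (p.2 : X) := by
    rw [(hfin.prod hfin).eventually_all]
    intro p _
    rcases le_or_gt (dist (p.1 : X) (p.2 : X)) L with h | h
    · exact .of_forall fun l => Or.inl h
    · filter_upwards [(eventually_lt_nhds h).filter_mono nhdsWithin_le_nhds] with l hl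
        using Or.inr hl
  have h2 : ∀ᶠ l in 𝓝[>] L, n * l < s :=
    (((continuous_const.mul continuous_id).tendsto L).eventually_lt_const hs).filter_mono
      nhdsWithin_le_nhds
  filter_upwards [h1, h2, self_mem_nhdsWithin] with l h1 h2 (hl : L < l)
  refine ⟨?_, fun y z hy hz heq => ?_⟩
  · rw [truncate_geomGraph_eq_iff]
    have hlL : n * L ≤ n * l := by gcongr
    refine sameBall_of_equiv (S := {y | dist (y : X) x ≤ s}) (Equiv.refl _)
      ?_ rfl (fun y hy => ?_) (fun y hy => ?_) fun y z _ => ?_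
    · show dist x x ≤ s
      rw [dist_self]
      exact (by positivity : 0 ≤ n * L).trans hs.le
    · exact (dist_le_of_mem_reachWithin hy (hL.trans hl.le)).trans h2.le
    · exact (dist_le_of_mem_reachWithin hy hL).trans hs.le
    · refine and_congr_right fun _ => ⟨fun h => ?_, fun h => h.trans hl.le⟩
      exact (h1 (y, z) ⟨y.2, z.2⟩).resolve_right h.not_gt
  · rcases h1 (y, z) ⟨hy, hz⟩ with h | h
    · exact absurd h (by rw [heq]; exact hl.not_ge)
    · exact h.ne heq.symm

end

/-! ### Families of test functions -/

section

variable {X : Type u} [MetricSpace X]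

/-- The radial function around `c` that is `1` up to distance `a`, `0` from distance `b` on, and
affine in between. -/
noncomputable def radialTent (c : X) (a b : ℝ) (y : X) : ℝ :=
  max 0 (min 1 ((b - dist y c) / (b - a)))

theorem continuous_radialTent (c : X) (a b : ℝ) : Continuous (radialTent c a b) := by
  unfold radialTent
  fun_prop

theorem radialTent_nonneg (c : X) (a b : ℝ) (y : X) : 0 ≤ radialTent c a b y := le_max_left _ _

theorem radialTent_le_one (c : X) (a b : ℝ) (y : X) : radialTent c a b y ≤ 1 :=
  max_le zero_le_one (min_le_left _ _)

theorem radialTent_eq_one {c : X} {a b : ℝ} (hab : a < b) {y : X} (hy : dist y c ≤ a) :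
    radialTent c a b y = 1 := by
  have : 1 ≤ (b - dist y c) / (b - a) := by
    rw [le_div_iff₀ (by linarith)]
    linarith
  rw [radialTent, min_eq_left this, max_eq_right zero_le_one]

theorem radialTent_eq_zero {c : X} {a b : ℝ} (hab : a < b) {y : X} (hy : b ≤ dist y c) :
    radialTent c a b y = 0 := by
  have : (b - dist y c) / (b - a) ≤ 0 := div_nonpos_of_nonpos_of_nonneg (by linarith) (by linarith)
  exact max_eq_left ((min_le_right _ _).trans this)

/-- A sequence of continuous functions with values in `[0, 1]` supported in `closedBall x R` that
contains arbitrarily sharp approximations of the indicator functions of `closedBall x s` and of the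
points of this ball. -/
structure IsTestFamily (x : X) (s R : ℝ) (φ : ℕ → X → ℝ) : Prop where
  continuous : ∀ k, Continuous (φ k)
  tsupport_subset : ∀ k, tsupport (φ k) ⊆ closedBall x R
  nonneg : ∀ k y, 0 ≤ φ k y
  le_one : ∀ k y, φ k y ≤ 1
  exists_plateau : ∀ δ > 0, ∃ k, ∃ ρ > 0, (∀ y, dist y x ≤ s + ρ → φ k y = 1) ∧
    ∀ y, s + δ ≤ dist y x → φ k y = 0
  exists_bump : ∀ y, dist y x ≤ s → ∀ δ > 0, ∃ k, φ k y = 1 ∧ ∀ z, δ ≤ dist z y → φ k z = 0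

theorem exists_isTestFamily [SecondCountableTopology X] (x : X) {s R : ℝ} (hsR : s < R) :
    ∃ φ : ℕ → X → ℝ, IsTestFamily x s R φ := by
  have : Nonempty X := ⟨x⟩
  obtain ⟨e, he⟩ := exists_surjective_nat (ℕ ⊕ ℕ × ℕ)
  have hη : ∀ k : ℕ, 0 < (R - s) / (2 * (k + 1)) := fun k => div_pos (by linarith) (by positivity)
  have hη' : ∀ k : ℕ, 2 * ((R - s) / (2 * (k + 1))) ≤ R - s := fun k => by
    have h : 2 * ((R - s) / (2 * ((k : ℝ) + 1))) = (R - s) / (k + 1) := by field_simp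
    rw [h]
    exact div_le_self (by linarith) (by simp)
  -- Plateaus: with η = (R - s) / (2(k + 1)), equal to 1 up to s + η and to 0 from s + 2η ≤ R on.
  let p : ℕ → X → ℝ := fun k =>
    radialTent x (s + (R - s) / (2 * (k + 1))) (s + 2 * ((R - s) / (2 * (k + 1))))
  -- Bumps around a dense sequence, at countably many scales. The factor `p 0` is 1 on `closedBall x
  -- s` and keeps the support inside `closedBall x R`.
  let b : ℕ × ℕ → X → ℝ := fun i y =>
    radialTent (TopologicalSpace.denseSeq X i.1) (1 / (i.2 + 1)) (2 / (i.2 + 1)) y * p 0 y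
  have hp0 : ∀ k y, R ≤ dist y x → p k y = 0 := fun k y hy =>
    radialTent_eq_zero (by linarith [hη k]) (by linarith [hη' k])
  have hp1 : ∀ k y, dist y x ≤ s → p k y = 1 := fun k y hy =>
    radialTent_eq_one (by linarith [hη k]) (by linarith [hη k])
  have hlt : ∀ k : ℕ, (1 : ℝ) / (k + 1) < 2 / (k + 1) := fun k => by
    gcongr
    norm_num
  refine ⟨fun k => Sum.elim p b (e k), ?_, ?_, ?_, ?_, ?_, ?_⟩
  · intro k
    rcases e k with i | i
    · exact continuous_radialTent _ _ _
    · exact (continuous_radialTent _ _ _).mul (continuous_radialTent _ _ _)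
  · intro k
    refine closure_minimal (fun y hy => ?_) isClosed_closedBall
    by_contra hcon
    have hR : R ≤ dist y x := by simpa using (not_le.1 hcon).le
    refine hy ?_
    rcases e k with i | i
    · exact hp0 i y hR
    · show _ * p 0 y = 0
      rw [hp0 0 y hR, mul_zero]
  · intro k y
    rcases e k with i | i
    · exact radialTent_nonneg _ _ _ _
    · exact mul_nonneg (radialTent_nonneg _ _ _ _) (radialTent_nonneg _ _ _ _)
  · intro k y
    rcases e k with i | i
    · exact radialTent_le_one _ _ _ _
    · exact mul_le_one₀ (radialTent_le_one _ _ _ _) (radialTent_nonneg _ _ _ _)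
        (radialTent_le_one _ _ _ _)
  · intro δ hδ
    obtain ⟨i, hi⟩ := exists_nat_one_div_lt (div_pos hδ (sub_pos.2 hsR))
    obtain ⟨k, hk⟩ := he (Sum.inl i)
    refine ⟨k, (R - s) / (2 * (i + 1)), hη i, fun y hy => ?_, fun y hy => ?_⟩
    · simp only [hk]
      exact radialTent_eq_one (by linarith [hη i]) hy
    · simp only [hk]
      refine radialTent_eq_zero (by linarith [hη i]) (le_trans ?_ hy)
      rw [lt_div_iff₀ (sub_pos.2 hsR)] at hi
      have : 2 * ((R - s) / (2 * (i + 1))) = 1 / (i + 1) * (R - s) := by field_simp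
      linarith
  · intro y hy δ hδ
    -- The center will be within 1/(i + 1) < δ/3 of y, so points at distance at least δ from y are
    -- beyond the outer radius 2/(i + 1).
    obtain ⟨i, hi⟩ := exists_nat_one_div_lt (by positivity : (0 : ℝ) < δ / 3)
    obtain ⟨j, hj⟩ := (TopologicalSpace.denseRange_denseSeq X).exists_dist_lt y
      (by positivity : (0 : ℝ) < 1 / (i + 1))
    obtain ⟨k, hk⟩ := he (Sum.inr (j, i))
    refine ⟨k, ?_, fun z hz => ?_⟩
    · simp only [hk]
      show radialTent _ _ _ y * p 0 y = 1
      rw [hp1 0 y hy, radialTent_eq_one (hlt i) hj.le, one_mul]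
    · simp only [hk]
      show radialTent _ _ _ z * p 0 z = 0
      rw [radialTent_eq_zero (hlt i), zero_mul]
      have h1 := dist_triangle_right z y (TopologicalSpace.denseSeq X j)
      have h2 : (2 : ℝ) / (i + 1) = 2 * (1 / (i + 1)) := by ring
      show (2 : ℝ) / (i + 1) ≤ _
      linarith

end

/-! ### Integrals against atomic measures -/

/-- The measure is a countable sum of Dirac masses at its atoms; no measurability of p is needed. -/
theorem IsAtomicMeasure.ae_of_forall_atom {X : Type u} [TopologicalSpace X] [MeasurableSpace X]
    [MeasurableSingletonClass X] {μ : Measure X} (hμ : IsAtomicMeasure μ) {p : X → Prop}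
    (h : ∀ y, μ {y} ≠ 0 → p y) : ∀ᵐ y ∂μ, p y := by
  obtain ⟨⟨ι, hι, q, rfl⟩, -⟩ := hμ
  rw [Measure.ae_sum_iff]
  intro i
  rw [ae_dirac_eq]
  refine h (q i) fun h0 => ?_
  rw [Measure.sum_apply _ (measurableSet_singleton _), ENNReal.tsum_eq_zero] at h0
  simpa using h0 i

theorem IsAtomicMeasure.one_le_of_ne_zero {X : Type u} [TopologicalSpace X] [MeasurableSpace X]
    [MeasurableSingletonClass X] {μ : Measure X} (hμ : IsAtomicMeasure μ) {y : X}
    (hy : μ {y} ≠ 0) : 1 ≤ μ {y} := by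
  obtain ⟨⟨ι, hι, q, rfl⟩, -⟩ := hμ
  rw [Measure.sum_apply _ (measurableSet_singleton _)] at hy ⊢
  obtain ⟨i, hi⟩ : ∃ i, (Measure.dirac (q i)) {y} ≠ 0 := by
    by_contra! hcon
    exact hy (by simp [hcon])
  refine le_trans ?_ (ENNReal.le_tsum i)
  rw [Measure.dirac_apply' _ (measurableSet_singleton y)] at hi ⊢
  have : q i ∈ ({y} : Set X) := by
    by_contra hcon
    exact hi (by simp [hcon])
  simp [this]

section

variable {X : Type u} [MetricSpace X] {Y : Type w} [MetricSpace Y] [MeasurableSpace Y]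

/-- The integral of `φ ∘ f` over a closed ball. -/
noncomputable def ballIntegral (y : Y) (R : ℝ) (f : closedBall y R → X) (ν : AtomicMeasure Y)
    (φ : X → ℝ) : ℝ :=
  ∫ z : closedBall y R, φ (f z) ∂((ν : Measure Y).comap Subtype.val)

variable [BorelSpace Y]

theorem comap_subtype_val_singleton (y : Y) (R : ℝ) (ν : Measure Y) (z : closedBall y R) :
    ν.comap Subtype.val {z} = ν {(z : Y)} := by
  rw [(MeasurableEmbedding.subtype_coe isClosed_closedBall.measurableSet).comap_apply]
  simp

variable [ProperSpace Y]

theorem isFiniteMeasure_comap_closedBall (y : Y) (R : ℝ) (ν : AtomicMeasure Y) :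
    IsFiniteMeasure ((ν : Measure Y).comap (Subtype.val : closedBall y R → Y)) := by
  refine ⟨?_⟩
  rw [(MeasurableEmbedding.subtype_coe isClosed_closedBall.measurableSet).comap_apply]
  simpa only [Set.image_univ, Subtype.range_coe] using ν.2.2 _ (isCompact_closedBall y R)

theorem integrable_comp_comap_closedBall (y : Y) (R : ℝ) {f : closedBall y R → X}
    (hf : Continuous f) (ν : AtomicMeasure Y) {φ : X → ℝ} (hφ : Continuous φ) :
    Integrable (fun z => φ (f z)) ((ν : Measure Y).comap (Subtype.val : closedBall y R → Y)) := by
  have := isFiniteMeasure_comap_closedBall y R ν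
  have : CompactSpace (closedBall y R) := isCompact_iff_compactSpace.1 (isCompact_closedBall y R)
  obtain ⟨C, hC⟩ := isCompact_univ.exists_bound_of_continuousOn (hφ.comp hf).continuousOn
  exact .of_bound (hφ.comp hf).aestronglyMeasurable C (.of_forall fun z => hC z trivial)

theorem ballIntegral_sum {ι : Type*} (y : Y) (R : ℝ) {f : closedBall y R → X} (hf : Continuous f)
    (ν : AtomicMeasure Y) (t : Finset ι) (c : ι → ℝ) {φ : ι → X → ℝ}
    (hφ : ∀ i, Continuous (φ i)) :
    ballIntegral y R f ν (fun a => ∑ i ∈ t, c i * φ i a) =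
      ∑ i ∈ t, c i * ballIntegral y R f ν (φ i) := by
  simp only [ballIntegral]
  rw [integral_finsetSum _ fun i _ =>
    (integrable_comp_comap_closedBall y R hf ν (hφ i)).const_mul (c i)]
  simp only [integral_const_mul]

theorem ae_comap_closedBall (y : Y) (R : ℝ) (ν : AtomicMeasure Y) {p : closedBall y R → Prop}
    (h : ∀ z : closedBall y R, (ν : Measure Y) {(z : Y)} ≠ 0 → p z) :
    ∀ᵐ z ∂((ν : Measure Y).comap (Subtype.val : closedBall y R → Y)), p z := by
  have h1 : ∀ᵐ z ∂(ν : Measure Y), ∀ hz : z ∈ closedBall y R, p ⟨z, hz⟩ :=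
    ν.2.ae_of_forall_atom fun z hz0 hz => h ⟨z, hz⟩ hz0
  rw [ae_iff] at h1 ⊢
  rw [(MeasurableEmbedding.subtype_coe isClosed_closedBall.measurableSet).comap_apply]
  refine measure_mono_null ?_ h1
  rintro _ ⟨z, hz, rfl⟩ hcon
  exact hz (hcon z.2)

omit [MetricSpace X] in
theorem exists_atom_of_ballIntegral_ne_zero {y : Y} {R : ℝ} {f : closedBall y R → X}
    {ν : AtomicMeasure Y} {φ : X → ℝ} (h : ballIntegral y R f ν φ ≠ 0) :
    ∃ z : closedBall y R, (ν : Measure Y) {(z : Y)} ≠ 0 ∧ φ (f z) ≠ 0 := by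
  by_contra! hcon
  exact h (integral_eq_zero_of_ae (ae_comap_closedBall y R ν hcon))

/-- Atoms have mass at least 1, so multiplicities only help this bound; the converse bound
`ballIntegral_le_ncard` needs mass at most 1. -/
theorem ncard_le_ballIntegral {y : Y} {R : ℝ} {f : closedBall y R → X} (hf : Continuous f)
    {ν : AtomicMeasure Y} {φ : X → ℝ} (hφ : Continuous φ) (hφ0 : ∀ a, 0 ≤ φ a)
    {Z : Set (closedBall y R)} (hZ : Z.Finite) (hν : ∀ z ∈ Z, (ν : Measure Y) {(z : Y)} ≠ 0)
    (h : ∀ z ∈ Z, φ (f z) = 1) : (Z.ncard : ℝ) ≤ ballIntegral y R f ν φ := by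
  have := isFiniteMeasure_comap_closedBall y R ν
  set m := (ν : Measure Y).comap (Subtype.val : closedBall y R → Y)
  have h1 : (Z.ncard : ℝ) ≤ m.real Z := by
    rw [← hZ.coe_toFinset, ← sum_measureReal_singleton, Set.ncard_coe_finset, Finset.cast_card]
    refine Finset.sum_le_sum fun z hz => ?_
    have hz := ν.2.one_le_of_ne_zero (hν z (hZ.mem_toFinset.1 hz))
    rw [← comap_subtype_val_singleton] at hz
    simpa [Measure.real] using ENNReal.toReal_mono (measure_ne_top m _) hz
  refine h1.trans ?_
  rw [← integral_indicator_one hZ.measurableSet]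
  refine integral_mono ((integrable_const 1).indicator hZ.measurableSet)
    (integrable_comp_comap_closedBall y R hf ν hφ) fun z => ?_
  by_cases hz : z ∈ Z
  · simp [hz, h z hz]
  · simp [hz, hφ0]

theorem ballIntegral_le_ncard {y : Y} {R : ℝ} {f : closedBall y R → X} (hf : Continuous f)
    {ν : AtomicMeasure Y} {φ : X → ℝ} (hφ : Continuous φ) (hφ1 : ∀ a, φ a ≤ 1)
    {Z : Set (closedBall y R)} (hZ : Z.Finite) (hν : ∀ z ∈ Z, (ν : Measure Y) {(z : Y)} ≤ 1)
    (h : ∀ z ∉ Z, (ν : Measure Y) {(z : Y)} ≠ 0 → φ (f z) = 0) :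
    ballIntegral y R f ν φ ≤ Z.ncard := by
  have := isFiniteMeasure_comap_closedBall y R ν
  set m := (ν : Measure Y).comap (Subtype.val : closedBall y R → Y)
  have h1 : m.real Z ≤ Z.ncard := by
    rw [← hZ.coe_toFinset, ← sum_measureReal_singleton, Set.ncard_coe_finset, Finset.cast_card]
    refine Finset.sum_le_sum fun z hz => ?_
    have hz := hν z (hZ.mem_toFinset.1 hz)
    rw [← comap_subtype_val_singleton] at hz
    simpa [Measure.real] using ENNReal.toReal_mono ENNReal.one_ne_top hz
  refine le_trans ?_ h1
  rw [← integral_indicator_one hZ.measurableSet]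
  refine integral_mono_ae (integrable_comp_comap_closedBall y R hf ν hφ)
    ((integrable_const 1).indicator hZ.measurableSet) (ae_comap_closedBall y R ν fun z hz0 => ?_)
  by_cases hz : z ∈ Z
  · simp [hz, hφ1]
  · simp [hz, h z hz hz0]

end

/-! ### Geometric graphs of nearby point processes -/

section

variable {X : Type u} [MetricSpace X] [MeasurableSpace X] [ProperSpace X] [BorelSpace X]
  {Y : Type u} [MetricSpace Y] [MeasurableSpace Y] [ProperSpace Y] [BorelSpace Y]

/-- A map between closed balls that almost preserves distances and almost preserves the centers. -/
structure IsNearIsometry {Y : Type w} [MetricSpace Y] {y : Y} {R : ℝ} (f : closedBall y R → X)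
    (x : X) (κ : ℝ) : Prop where
  dist_le : ∀ a b, dist (f a) (f b) ≤ (1 + κ) * dist a b
  le_dist : ∀ a b, dist a b ≤ (1 + κ) * dist (f a) (f b)
  center : ∀ h, dist (f ⟨y, h⟩) x < κ

omit [MeasurableSpace X] [ProperSpace X] [BorelSpace X] in
theorem IsNearIsometry.continuous {Y : Type w} [MetricSpace Y] {y : Y} {R : ℝ}
    {f : closedBall y R → X} {x : X} {κ : ℝ} (hf : IsNearIsometry f x κ) : Continuous f :=
  (LipschitzWith.of_dist_le' hf.dist_le).continuous

/-- Matching each atom near x with an atom of ν, and root with root, is injective by separation and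
bijective by the count. Distances change by at most 2κ and a factor 1 + κ, too little to cross L. -/
theorem sameBall_of_matching {x : X} {μ : AtomicMeasure X} {y : Y} {ν : AtomicMeasure Y}
    {R s κ L : ℝ} {n : ℕ} {f : closedBall y R → X} (hf : IsNearIsometry f x κ) (hκ : 0 < κ)
    (hL : 0 < L) (hR : n * L ≤ R) (hs : (1 + κ) * (n * L) ≤ s)
    (hlt : ∀ a b : geomVertices x μ, dist (a : X) x ≤ s → dist (b : X) x ≤ s →
      dist (a : X) b < L → (1 + κ) * (dist (a : X) b + 2 * κ) ≤ L)
    (hgt : ∀ a b : geomVertices x μ, dist (a : X) x ≤ s → dist (b : X) x ≤ s →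
      L < dist (a : X) b → (1 + κ) * L + 2 * κ < dist (a : X) b)
    (hsep : ∀ a b : geomVertices x μ, dist (a : X) x ≤ s → dist (b : X) x ≤ s →
      a ≠ b → 2 * κ < dist (a : X) b)
    (hgen : ∀ a b : geomVertices x μ,
      a ∈ (fullGeomGraph x μ L).reachWithin ⟨x, self_mem_geomVertices x μ⟩ n →
      dist (b : X) x ≤ s → dist (a : X) b ≠ L)
    (hmatch : ∀ a : X, (μ : Measure X) {a} ≠ 0 → dist a x ≤ s →
      ∃ z : closedBall y R, (ν : Measure Y) {(z : Y)} ≠ 0 ∧ dist (f z) a < κ)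
    (hcard : {z : closedBall y R | (ν : Measure Y) {(z : Y)} ≠ 0 ∧ dist (f z) x ≤ s + κ}.ncard + 1 ≤
      {a : geomVertices x μ | dist (a : X) x ≤ s}.ncard) :
    SameBall n (fullGeomGraph x μ L) ⟨x, self_mem_geomVertices x μ⟩
      (fullGeomGraph y ν L) ⟨y, self_mem_geomVertices y ν⟩ := by
  have hnL : 0 ≤ n * L := by positivity
  have hyR : y ∈ closedBall y R := mem_closedBall_self (hnL.trans hR)
  have hs0 : 0 ≤ s := le_trans (by positivity) hs
  set S : Set (geomVertices x μ) := {a | dist (a : X) x ≤ s} with hSdef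
  have hSfin : S.Finite := finite_geomVertices_inter_closedBall x μ s
  have hex : ∀ a : geomVertices x μ, a ∈ S → ∃ z : closedBall y R,
      (z : Y) ∈ geomVertices y ν ∧ dist (f z) a < κ ∧ ((a : X) = x → (z : Y) = y) := by
    rintro ⟨a, ha⟩ has
    by_cases hax : a = x
    · subst hax
      exact ⟨⟨y, hyR⟩, Or.inl rfl, hf.center _, fun _ => rfl⟩
    · obtain ⟨z, hz, hza⟩ := hmatch a (ha.resolve_left hax) has
      exact ⟨z, Or.inr hz, hza, fun h => absurd h hax⟩
  have : Nonempty (closedBall y R) := ⟨⟨y, hyR⟩⟩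
  choose! h hv hd hroot using hex
  let T : Set (geomVertices y ν) :=
    {b | ∃ hb : (b : Y) ∈ closedBall y R, dist (f ⟨b, hb⟩) x ≤ s + κ}
  have hTfin : T.Finite := by
    refine (finite_geomVertices_inter_closedBall y ν R).subset ?_
    rintro b ⟨hb, -⟩
    exact hb
  -- The `+ 1` in `hcard` accounts for the root y, which need not be an atom.
  have hTS : T.ncard ≤ S.ncard := by
    set Z := {z : closedBall y R | (ν : Measure Y) {(z : Y)} ≠ 0 ∧ dist (f z) x ≤ s + κ}
    have hZfin : Z.Finite := by
      refine Set.Finite.of_finite_image (f := Subtype.val) ?_ Subtype.val_injective.injOn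
      refine (ν.2.finite_atoms (isCompact_closedBall y R)).subset ?_
      rintro _ ⟨z, hz, rfl⟩
      exact ⟨z.2, hz.1⟩
    have hsub : Subtype.val '' T ⊆ insert y (Subtype.val '' Z) := by
      rintro _ ⟨b, ⟨hb, hbs⟩, rfl⟩
      rcases b.2 with h | h
      · exact Or.inl h
      · exact Or.inr ⟨⟨b, hb⟩, ⟨h, hbs⟩, rfl⟩
    rw [← Set.ncard_image_of_injective T Subtype.val_injective]
    refine (Set.ncard_le_ncard hsub ((hZfin.image _).insert _)).trans ?_
    refine (Set.ncard_insert_le _ _).trans ?_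
    rwa [Set.ncard_image_of_injective Z Subtype.val_injective]
  let e₀ : S → T := fun a => ⟨⟨h a, hv a a.2⟩, (h a).2, by
    have h1 := dist_triangle (f (h a)) (a : X) x
    have h2 := hd a a.2
    have h3 : dist ((a : geomVertices x μ) : X) x ≤ s := a.2
    show dist (f (h a)) x ≤ s + κ
    linarith⟩
  have hinj : Function.Injective e₀ := by
    intro a b hab
    have hab : h a = h b := Subtype.ext (congrArg (fun t : T => ((t : geomVertices y ν) : Y)) hab)
    by_contra hne
    have h1 := hsep a b a.2 b.2 fun h => hne (Subtype.ext h)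
    have h2 := hd a a.2
    have h3 := hd b b.2
    rw [hab] at h2
    have h4 := dist_triangle_left ((a : geomVertices x μ) : X) b (f (h b))
    linarith
  have : Finite S := hSfin
  have : Finite T := hTfin
  have hbij : Function.Bijective e₀ := hinj.bijective_of_nat_card_le hTS
  have hxS : (⟨x, self_mem_geomVertices x μ⟩ : geomVertices x μ) ∈ S := by
    show dist x x ≤ s
    rwa [dist_self]
  refine sameBall_of_equiv (Equiv.ofBijective e₀ hbij) hxS (Subtype.ext (hroot _ hxS rfl))
    (fun a ha => ?_) (fun b hb => ?_) fun a b ha => ?_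
  · refine (dist_le_of_mem_reachWithin ha hL.le).trans (le_trans ?_ hs)
    nlinarith
  · have hb := dist_le_of_mem_reachWithin hb hL.le
    refine ⟨hb.trans hR, ?_⟩
    have h1 := dist_triangle (f ⟨b, hb.trans hR⟩) (f ⟨y, hyR⟩) x
    have h2 := hf.center hyR
    have h3 : dist (f ⟨b, hb.trans hR⟩) (f ⟨y, hyR⟩) ≤ (1 + κ) * dist (b : Y) y :=
      hf.dist_le ⟨b, hb.trans hR⟩ ⟨y, hyR⟩
    have h4 : (1 + κ) * dist (b : Y) y ≤ (1 + κ) * (n * L) := by gcongr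
    linarith
  · have h1 := hd a a.2
    have h2 := hd b b.2
    have h3 := dist_triangle4 ((a : geomVertices x μ) : X) (f (h a)) (f (h b)) b
    rw [dist_comm _ (f (h a))] at h3
    have h4 := dist_triangle4_right (f (h a)) (f (h b)) ((a : geomVertices x μ) : X) b
    have h5 := hf.dist_le (h a) (h b)
    have h6 := hf.le_dist (h a) (h b)
    have hne : (a : geomVertices x μ) ≠ b ↔
        ((Equiv.ofBijective e₀ hbij a : T) : geomVertices y ν) ≠ Equiv.ofBijective e₀ hbij b := by
      rw [Ne, Ne, ← Subtype.ext_iff, ← Subtype.ext_iff, EmbeddingLike.apply_eq_iff_eq]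
    refine and_congr hne ?_
    show dist ((a : geomVertices x μ) : X) b ≤ L ↔ dist (h a) (h b) ≤ L
    -- Genericity excludes equality with L, the one case an arbitrarily small perturbation could
    -- flip.
    rcases lt_or_gt_of_ne (hgen a b ha b.2) with hlt' | hgt'
    · have h7 := hlt a b a.2 b.2 hlt'
      refine iff_of_true hlt'.le (h6.trans (le_trans ?_ h7))
      gcongr
      linarith
    · have h7 := hgt a b a.2 b.2 hgt'
      refine iff_of_false hgt'.not_ge fun hcon => ?_
      have h8 : (1 + κ) * dist (h a) (h b) ≤ (1 + κ) * L := by gcongr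
      linarith

end

/-! ### Finite determination of truncated graphs by test integrals -/

section

variable {X : Type u} [MetricSpace X] [MeasurableSpace X] [ProperSpace X] [BorelSpace X]

theorem ncard_geomVertices_inter_closedBall {x : X} {μ : AtomicMeasure X}
    (hμx : (μ : Measure X) {x} = 0) {s R : ℝ} (hs : 0 ≤ s) (hsR : s ≤ R) :
    {a : geomVertices x μ | dist (a : X) x ≤ s}.ncard =
      {z : closedBall x R | (μ : Measure X) {(z : X)} ≠ 0 ∧ dist (z : X) x ≤ s}.ncard + 1 := by
  have hfin : {z : closedBall x R | (μ : Measure X) {(z : X)} ≠ 0 ∧ dist (z : X) x ≤ s}.Finite := by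
    refine Set.Finite.of_finite_image (f := Subtype.val) ?_ Subtype.val_injective.injOn
    refine (μ.2.finite_atoms (isCompact_closedBall x R)).subset ?_
    rintro _ ⟨z, hz, rfl⟩
    exact ⟨z.2, hz.1⟩
  rw [← Set.ncard_image_of_injective _ Subtype.val_injective,
    ← Set.ncard_image_of_injective {z : closedBall x R | _} Subtype.val_injective,
    ← Set.ncard_insert_of_notMem _ (hfin.image _)]
  · congr 1
    ext a
    constructor
    · rintro ⟨⟨a, ha⟩, has, rfl⟩
      rcases ha with h | h
      · exact Or.inl h
      · exact Or.inr ⟨⟨a, has.trans hsR⟩, ⟨h, has⟩, rfl⟩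
    · rintro (rfl | ⟨z, hz, rfl⟩)
      · exact ⟨⟨a, self_mem_geomVertices a μ⟩, by simpa using hs, rfl⟩
      · exact ⟨⟨z, Or.inr hz.1⟩, hz.2, rfl⟩
  · rintro ⟨z, hz, hzx⟩
    exact hz.1 (by rw [hzx, hμx])

/-- The truncated geometric graph of a generic configuration is determined by finitely many
integrals of test functions, up to small errors and up to small perturbations of the metric. -/
theorem exists_forall_truncate_geomGraph_eq {x : X} {s R L : ℝ} {n : ℕ} {φ : ℕ → X → ℝ}
    (hφ : IsTestFamily x s R φ) (hL : 0 < L) (hs : n * L < s) (hsR : s < R) {μ : AtomicMeasure X}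
    (hsimple : ∀ a, (μ : Measure X) {a} ≤ 1) (hμx : (μ : Measure X) {x} = 0)
    (hgen : ∀ a b : geomVertices x μ,
      a ∈ (fullGeomGraph x μ L).reachWithin ⟨x, self_mem_geomVertices x μ⟩ n →
      dist (b : X) x ≤ s → dist (a : X) b ≠ L) :
    ∃ κ > 0, ∃ j : ℕ, ∀ (Y : Type u) [MetricSpace Y] [MeasurableSpace Y] [ProperSpace Y]
      [BorelSpace Y] (y : Y) (ν : AtomicMeasure Y) (f : closedBall y R → X),
      IsNearIsometry f x κ →
      (∀ k < j, |ballIntegral y R f ν (φ k) - ballIntegral x R Subtype.val μ (φ k)| < κ) →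
      RootedGraphClass.truncate n (geomGraph x μ L) =
        RootedGraphClass.truncate n (geomGraph y ν L) := by
  have hnL : 0 ≤ n * L := by positivity
  have hs0 : 0 ≤ s := hnL.trans hs.le
  have hfin := finite_geomVertices_inter_closedBall x μ s
  -- the atoms stay away from an annulus around `closedBall x s`
  obtain ⟨δ, hδ, hann⟩ : ∃ δ > 0, ∀ a : X, (μ : Measure X) {a} ≠ 0 → dist a x < s + δ →
      dist a x ≤ s := by
    have h1 : ∀ᶠ δ in 𝓝[>] (0 : ℝ), ∀ a ∈ {a ∈ closedBall x (s + 1) | (μ : Measure X) {a} ≠ 0},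
        dist a x < s + δ → dist a x ≤ s := by
      rw [(μ.2.finite_atoms (isCompact_closedBall x (s + 1))).eventually_all]
      intro a _
      rcases le_or_gt (dist a x) s with h | h
      · exact .of_forall fun _ _ => h
      · have : ∀ᶠ δ in 𝓝[>] (0 : ℝ), δ < dist a x - s :=
          (eventually_lt_nhds (by linarith)).filter_mono nhdsWithin_le_nhds
        filter_upwards [this] with δ h1 h2
        linarith
    have h2 : ∀ᶠ δ in 𝓝[>] (0 : ℝ), δ < 1 :=
      (eventually_lt_nhds one_pos).filter_mono nhdsWithin_le_nhds
    obtain ⟨δ, ⟨h1, h2⟩, h3⟩ := ((h1.and h2).and self_mem_nhdsWithin).exists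
    refine ⟨δ, h3, fun a ha has => h1 a ⟨?_, ha⟩ has⟩
    rw [mem_closedBall]
    linarith
  obtain ⟨k₀, ρ, hρ, hk₀1, hk₀0⟩ := hφ.exists_plateau δ hδ
  -- smallness conditions on the error
  have hsmall : ∀ᶠ κ in 𝓝[>] (0 : ℝ), κ < 1 / 2 ∧ κ ≤ ρ ∧ (1 + κ) * (n * L) ≤ s ∧
      ∀ p ∈ {a : geomVertices x μ | dist (a : X) x ≤ s} ×ˢ
        {a : geomVertices x μ | dist (a : X) x ≤ s},
        (dist (p.1 : X) p.2 < L → (1 + κ) * (dist (p.1 : X) p.2 + 2 * κ) ≤ L) ∧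
        (L < dist (p.1 : X) p.2 → (1 + κ) * L + 2 * κ < dist (p.1 : X) p.2) ∧
        (p.1 ≠ p.2 → 2 * κ < dist (p.1 : X) p.2) := by
    have hlt : ∀ {g : ℝ → ℝ} {c : ℝ}, Continuous g → g 0 < c → ∀ᶠ κ in 𝓝[>] (0 : ℝ), g κ < c :=
      fun hg h => ((hg.tendsto 0).eventually_lt_const h).filter_mono nhdsWithin_le_nhds
    refine (hlt (g := fun κ => κ) (by fun_prop) (by norm_num)).and (.and
      ((hlt (g := fun κ => κ) (by fun_prop) hρ).mono fun _ h => h.le) (.and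
      ((hlt (g := fun κ => (1 + κ) * (n * L)) (by fun_prop) (by simpa using hs)).mono
        fun _ h => h.le) ?_))
    rw [(hfin.prod hfin).eventually_all]
    intro p _
    simp only [eventually_and, eventually_imp_distrib_left]
    refine ⟨fun h => ?_, fun h => ?_, fun h => ?_⟩
    · exact (hlt (g := fun κ => (1 + κ) * (dist (p.1 : X) p.2 + 2 * κ)) (by fun_prop)
        (by simpa using h)).mono fun _ h => h.le
    · exact hlt (g := fun κ => (1 + κ) * L + 2 * κ) (by fun_prop) (by simpa using h)
    · exact hlt (g := fun κ => 2 * κ) (by fun_prop)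
        (by simpa using fun h' => h (Subtype.ext h'))
  obtain ⟨κ, ⟨hκ2, hκρ, hκs, hpairs⟩, hκ⟩ := (hsmall.and self_mem_nhdsWithin).exists
  replace hκ : 0 < κ := hκ
  have hbump := fun a : X => fun h => hφ.exists_bump a h κ hκ
  choose! k hk1 hk0 using hbump
  obtain ⟨j, hj⟩ := ((hfin.image fun a : geomVertices x μ => k a).insert k₀).bddAbove
  -- `j` bounds all the indices used, and the comparison range is strict.
  refine ⟨κ, hκ, j + 1, fun Y _ _ _ _ y ν f hf hclose => ?_⟩
  have hclose₀ := hclose k₀ (Nat.lt_succ_of_le (hj (Set.mem_insert _ _)))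
  rw [truncate_geomGraph_eq_iff]
  refine sameBall_of_matching (s := s) hf hκ hL (hs.le.trans hsR.le) hκs
    (fun a b ha hb => (hpairs (a, b) ⟨ha, hb⟩).1) (fun a b ha hb => (hpairs (a, b) ⟨ha, hb⟩).2.1)
    (fun a b ha hb => (hpairs (a, b) ⟨ha, hb⟩).2.2) hgen (fun a ha has => ?_) ?_
  · have h1 := hclose (k a) (Nat.lt_succ_of_le
      (hj (Set.mem_insert_of_mem _ ⟨⟨a, Or.inr ha⟩, has, rfl⟩)))
    -- The atom a makes this integral at least 1, so the one against ν exceeds 1 - κ > 0 and some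
    -- atom of ν lies in the bump.
    have h2 : ((1 : ℕ) : ℝ) ≤ ballIntegral x R Subtype.val μ (φ (k a)) := by
      rw [← Set.ncard_singleton (⟨a, has.trans hsR.le⟩ : closedBall x R)]
      refine ncard_le_ballIntegral continuous_subtype_val (hφ.continuous _) (hφ.nonneg _)
        (Set.finite_singleton _) ?_ ?_
      · rintro _ rfl
        exact ha
      · rintro _ rfl
        exact hk1 a has
    obtain ⟨z, hz, hzφ⟩ := exists_atom_of_ballIntegral_ne_zero (y := y) (R := R) (f := f) (ν := ν)
      (φ := φ (k a)) (by
        intro h0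
        rw [h0, abs_lt] at h1
        push_cast at h2
        linarith)
    exact ⟨z, hz, not_le.1 fun h => hzφ (hk0 a has _ h)⟩
  · rw [ncard_geomVertices_inter_closedBall hμx hs0 hsR.le, Nat.add_le_add_iff_right]
    have hfinZ : ∀ (p : closedBall y R → Prop),
        {z : closedBall y R | (ν : Measure Y) {(z : Y)} ≠ 0 ∧ p z}.Finite := fun p => by
      refine Set.Finite.of_finite_image (f := Subtype.val) ?_ Subtype.val_injective.injOn
      refine (ν.2.finite_atoms (isCompact_closedBall y R)).subset ?_
      rintro _ ⟨z, hz, rfl⟩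
      exact ⟨z.2, hz.1⟩
    have hfinW : {z : closedBall x R | (μ : Measure X) {(z : X)} ≠ 0 ∧ dist (z : X) x ≤ s}.Finite := by
      refine Set.Finite.of_finite_image (f := Subtype.val) ?_ Subtype.val_injective.injOn
      refine (μ.2.finite_atoms (isCompact_closedBall x R)).subset ?_
      rintro _ ⟨z, hz, rfl⟩
      exact ⟨z.2, hz.1⟩
    have h1 := ncard_le_ballIntegral hf.continuous (hφ.continuous k₀) (hφ.nonneg k₀)
      (hfinZ fun z => dist (f z) x ≤ s + κ) (fun z hz => hz.1)
      fun z hz => hk₀1 _ (hz.2.trans (by linarith))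
    have h2 := ballIntegral_le_ncard (ν := μ) continuous_subtype_val (hφ.continuous k₀)
      (hφ.le_one k₀) hfinW (fun z _ => hsimple z) fun z hz hz0 => hk₀0 _ (not_lt.1 fun h =>
        hz ⟨hz0, hann _ hz0 h⟩)
    rw [abs_lt] at hclose₀
    -- The two counts are integers and the plateau integrals differ by less than κ < 1.
    have h3 : ∀ p q : ℕ, (p : ℝ) < q + 1 → p ≤ q := fun p q h => by
      exact_mod_cast Nat.lt_succ_iff.1 (by exact_mod_cast h)
    exact h3 _ _ (by linarith)

end

/-! ### Small distortion -/

theorem EReal.le_coe_abs (a : EReal) : a ≤ (a.abs : EReal) := by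
  induction a with
  | bot => exact bot_le
  | top => exact le_rfl
  | coe a =>
    rw [EReal.coe_abs]
    exact_mod_cast le_abs_self a

theorem dist_le_of_absLogDilation_lt {Y : Type v} {Z : Type w} [MetricSpace Y] [MetricSpace Z]
    {f : Y → Z} {κ : ℝ} (hκ : 0 < κ) (h : absLogDilation f < ENNReal.ofReal (Real.log (1 + κ)))
    (a b : Y) : dist (f a) (f b) ≤ (1 + κ) * dist a b := by
  rcases eq_or_ne a b with rfl | hab
  · simp
  have hns : ¬ Subsingleton Y := fun _ => hab (Subsingleton.elim a b)
  rw [absLogDilation, if_neg hns] at h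
  have hdil : dilation f ≤ ENNReal.ofReal (1 + κ) := by
    rw [← ENNReal.log_le_log_iff, ENNReal.log_ofReal_of_pos (by linarith)]
    refine (EReal.le_coe_abs _).trans ?_
    have := EReal.coe_ennreal_le_coe_ennreal_iff.2 h.le
    rwa [EReal.coe_ennreal_ofReal, max_eq_left (Real.log_nonneg (by linarith))] at this
  have h1 : edist (f a) (f b) / edist a b ≤ ENNReal.ofReal (1 + κ) :=
    le_trans (le_iSup_of_le a (le_iSup_of_le b
      (le_iSup_of_le (f := fun _ : a ≠ b => edist (f a) (f b) / edist a b) hab le_rfl))) hdil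
  rw [ENNReal.div_le_iff (by simpa using hab) (edist_ne_top a b), edist_dist, edist_dist,
    ← ENNReal.ofReal_mul (by linarith)] at h1
  exact (ENNReal.ofReal_le_ofReal_iff (by positivity)).1 h1

theorem exists_isNearIsometry_of_pointedDistortion_lt {X : Type u} [MetricSpace X] {x : X} {R : ℝ}
    (hR : 0 < R) {κ : ℝ} (hκ : 0 < κ) : ∃ ε : ℝ≥0∞, 0 < ε ∧ ∀ (Y : Type w) [MetricSpace Y] (y : Y)
      (f : closedBall y R ≃ₜ closedBall x R),
      pointedDistortion f (ballCenter y hR) (ballCenter x hR) < ε →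
        IsNearIsometry (fun z => (f z : X)) x κ := by
  refine ⟨min (ENNReal.ofReal (Real.log (1 + κ))) (ENNReal.ofReal κ), ?_, fun Y _ y f hf => ?_⟩
  · rw [lt_min_iff, ENNReal.ofReal_pos, ENNReal.ofReal_pos]
    exact ⟨Real.log_pos (by linarith), hκ⟩
  · rw [pointedDistortion, lt_min_iff] at hf
    obtain ⟨h1, h2⟩ := hf
    refine ⟨dist_le_of_absLogDilation_lt hκ (lt_of_le_of_lt ?_ h1), fun a b => ?_, fun _ => ?_⟩
    · rw [add_assoc, add_assoc]
      exact le_self_add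
    · have h3 := dist_le_of_absLogDilation_lt (f := f.symm) hκ (lt_of_le_of_lt ?_ h1) (f a) (f b)
      · rwa [f.symm_apply_apply, f.symm_apply_apply] at h3
      · rw [add_assoc, add_assoc, add_left_comm]
        exact le_self_add
    · have h3 : edist (f (ballCenter y hR)) (ballCenter x hR) < ENNReal.ofReal κ := by
        refine lt_of_le_of_lt ?_ h2
        exact le_add_self.trans le_self_add
      rw [edist_dist, ENNReal.ofReal_lt_ofReal_iff hκ] at h3
      exact h3

/-! ### Convergence in law of locally determined events -/

/-- The Cramér-Wold theorem. -/
theorem MeasureTheory.TendstoInDistribution.of_forall_inner {E : Type*} [NormedAddCommGroup E]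
    [InnerProductSpace ℝ E] [FiniteDimensional ℝ E] [MeasurableSpace E] [BorelSpace E]
    {Ω : ℕ → Type v} [∀ N, MeasurableSpace (Ω N)] {P : ∀ N, Measure (Ω N)}
    [∀ N, IsProbabilityMeasure (P N)] {Ω' : Type w} [MeasurableSpace Ω'] {P' : Measure Ω'}
    [IsProbabilityMeasure P'] {Z : ∀ N, Ω N → E} {Z' : Ω' → E}
    (hZ : ∀ N, AEMeasurable (Z N) (P N)) (hZ' : AEMeasurable Z' P')
    (h : ∀ t : E, TendstoInDistribution (fun N ω => inner ℝ (Z N ω) t) atTop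
      (fun ω => inner ℝ (Z' ω) t) P P') :
    TendstoInDistribution Z atTop Z' P P' := by
  refine ⟨hZ, hZ', ProbabilityMeasure.tendsto_iff_tendsto_charFun.2 fun t => ?_⟩
  -- The characteristic function of Z at t is that of ⟨Z, t⟩ at 1.
  have h1 := ProbabilityMeasure.tendsto_iff_tendsto_charFun.1 (h t).tendsto 1
  convert h1 using 2
  · simp only [ProbabilityMeasure.coe_mk]
    rw [charFun_apply, charFun_apply_real, integral_map (hZ _) (by fun_prop),
      integral_map ((h t).forall_aemeasurable _) (by fun_prop)]
    simp
  · simp only [ProbabilityMeasure.coe_mk]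
    rw [charFun_apply, charFun_apply_real, integral_map hZ' (by fun_prop),
      integral_map (h t).aemeasurable_limit (by fun_prop)]
    simp

/-- Almost every point of E' has finitely many coordinates whose approximate values force `E N` for
large N. Such values form open sets of vectors, to which finite-dimensional portmanteau applies. -/
theorem measure_le_liminf_of_locally_determined {Ω : ℕ → Type v} [∀ N, MeasurableSpace (Ω N)]
    {P : ∀ N, Measure (Ω N)} [∀ N, IsProbabilityMeasure (P N)] {Ω' : Type w} [MeasurableSpace Ω']
    {P' : Measure Ω'} [IsProbabilityMeasure P'] {T : ∀ N, Ω N → ℕ → ℝ} {T' : Ω' → ℕ → ℝ}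
    (hT : ∀ N, Measurable (T N)) (hT' : Measurable T')
    (hconv : ∀ (j : ℕ) (c : Fin j → ℝ), TendstoInDistribution
      (fun N ω => ∑ k, c k * T N ω k) atTop (fun ω => ∑ k, c k * T' ω k) P P')
    {E : ∀ N, Set (Ω N)} {E' : Set Ω'}
    (hE : ∀ᵐ ω ∂P', ω ∈ E' → ∃ κ > 0, ∃ j : ℕ, ∃ N₀, ∀ N ≥ N₀, ∀ ω₁ : Ω N,
      (∀ k < j, |T N ω₁ k - T' ω k| < κ) → ω₁ ∈ E N) :
    P' E' ≤ liminf (fun N => P N (E N)) atTop := by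
  -- The index j is both the number of coordinates and the threshold for N, which makes the
  -- preimages of `W j` under the limit increase with j.
  let W : ∀ j : ℕ, Set (EuclideanSpace ℝ (Fin j)) := fun j =>
    {v | ∃ κ > 0, ∀ N ≥ j, ∀ ω : Ω N, (∀ k : Fin j, |T N ω k - v k| < κ) → ω ∈ E N}
  let vec : ∀ j : ℕ, (ℕ → ℝ) → EuclideanSpace ℝ (Fin j) := fun j t => WithLp.toLp 2 fun k => t k
  have hvec : ∀ j, Measurable (vec j) := fun j => by fun_prop
  have hWopen : ∀ j, IsOpen (W j) := by
    intro j
    rw [isOpen_iff_mem_nhds]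
    rintro v ⟨κ, hκ, hv⟩
    have h1 : ∀ᶠ v' in 𝓝 v, ∀ k : Fin j, |v' k - v k| < κ / 2 := by
      rw [eventually_all]
      intro k
      have hc : Continuous fun v' : EuclideanSpace ℝ (Fin j) => |v' k - v k| := by fun_prop
      exact (hc.tendsto v).eventually_lt_const (by simpa using hκ)
    filter_upwards [h1] with v' hv'
    refine ⟨κ / 2, by positivity, fun N hN ω hω => hv N hN ω fun k => ?_⟩
    have := abs_add_le (T N ω k - v' k) (v' k - v k)
    rw [sub_add_sub_cancel] at this
    linarith [hω k, hv' k]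
  have hmono : Monotone fun j => {ω | vec j (T' ω) ∈ W j} := by
    intro i j hij ω
    rintro ⟨κ, hκ, h⟩
    exact ⟨κ, hκ, fun N hN ω₁ hω₁ => h N (hij.trans hN) ω₁ fun k => hω₁ (Fin.castLE hij k)⟩
  have hcover : E' ≤ᵐ[P'] ⋃ j, {ω | vec j (T' ω) ∈ W j} := by
    filter_upwards [hE] with ω hω hωE
    obtain ⟨κ, hκ, j, N₀, h⟩ := hω hωE
    refine Set.mem_iUnion.2 ⟨max j N₀, κ, hκ, fun N hN ω₁ hω₁ => ?_⟩
    exact h N ((le_max_right _ _).trans hN) ω₁ fun k hk =>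
      hω₁ ⟨k, hk.trans_le (le_max_left _ _)⟩
  refine (measure_mono_ae hcover).trans ?_
  rw [hmono.measure_iUnion]
  refine iSup_le fun j => ?_
  have hlim : TendstoInDistribution (fun N ω => vec j (T N ω)) atTop (fun ω => vec j (T' ω)) P P' := by
    refine .of_forall_inner (fun N => ((hvec j).comp (hT N)).aemeasurable)
      ((hvec j).comp hT').aemeasurable fun t => ?_
    simpa [vec, PiLp.inner_apply] using hconv j t
  have h1 := ProbabilityMeasure.le_liminf_measure_open_of_tendsto hlim.tendsto (hWopen j)
  simp only [ProbabilityMeasure.coe_mk] at h1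
  rw [Measure.map_apply (f := fun ω => vec j (T' ω)) ((hvec j).comp hT') (hWopen j).measurableSet] at h1
  refine h1.trans (liminf_le_liminf ?_)
  filter_upwards [eventually_ge_atTop j] with N hN
  rw [Measure.map_apply (f := fun ω => vec j (T N ω)) ((hvec j).comp (hT N)) (hWopen j).measurableSet]
  refine measure_mono ?_
  rintro ω ⟨κ, hκ, h⟩
  exact h N hN ω fun k => by simpa [vec] using hκ

/-! ### Measurability -/

theorem measurable_ballIntegral {X : Type u} [MetricSpace X] {Y : Type w} [MetricSpace Y]
    [MeasurableSpace Y] [BorelSpace Y] [MeasurableSpace X] [OpensMeasurableSpace X] (y : Y) (R : ℝ)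
    {f : closedBall y R → X}
    (hf : Continuous f) {φ : X → ℝ} (hφ : Continuous φ) (hφ0 : ∀ a, 0 ≤ φ a) :
    Measurable fun ν : AtomicMeasure Y => ballIntegral y R f ν φ := by
  have hmap : Measurable fun ν : AtomicMeasure Y =>
      (ν : Measure Y).comap (Subtype.val : closedBall y R → Y) := by
    refine Measure.measurable_of_measurable_coe _ fun s hs => ?_
    have hemb := MeasurableEmbedding.subtype_coe (isClosed_closedBall (x := y) (ε := R)).measurableSet
    simp only [hemb.comap_apply]
    exact (Measure.measurable_coe (hemb.measurableSet_image.2 hs)).comp measurable_subtype_coe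
  have hint : ∀ ν : AtomicMeasure Y, ballIntegral y R f ν φ =
      (∫⁻ z, ENNReal.ofReal (φ (f z)) ∂((ν : Measure Y).comap
        (Subtype.val : closedBall y R → Y))).toReal := fun ν =>
    integral_eq_lintegral_of_nonneg_ae (.of_forall fun z => hφ0 _)
      (hφ.comp hf).aestronglyMeasurable
  simp only [hint]
  exact ((Measure.measurable_lintegral
    (hφ.comp hf).measurable.ennreal_ofReal).comp hmap).ennreal_toReal

/-! ### Sets determined by truncations -/

/-- The union of the cylinders of level `n` contained in `O`. -/
def RootedGraphClass.cylinderInterior (n : ℕ) (O : Set RootedGraphClass.{u}) :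
    Set RootedGraphClass.{u} :=
  {g | ∀ h, truncate n h = truncate n g → h ∈ O}

theorem RootedGraphClass.cylinderInterior_subset (n : ℕ) (O : Set RootedGraphClass.{u}) :
    cylinderInterior n O ⊆ O :=
  fun g hg => hg g rfl

theorem RootedGraphClass.mem_cylinderInterior_congr {n : ℕ} {O : Set RootedGraphClass.{u}}
    {g h : RootedGraphClass.{u}} (H : truncate n g = truncate n h) :
    g ∈ cylinderInterior n O ↔ h ∈ cylinderInterior n O := by
  simp only [cylinderInterior, Set.mem_ofPred_eq, H]

theorem RootedGraphClass.cylinderInterior_mono (O : Set RootedGraphClass.{u}) :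
    Monotone fun n => cylinderInterior n O :=
  fun _ _ hmn _ hg h H => hg h (truncate_eq_of_le hmn H)

theorem RootedGraphClass.iUnion_cylinderInterior {O : Set RootedGraphClass.{u}} (hO : IsOpen O) :
    ⋃ n, cylinderInterior n O = O := by
  refine (Set.iUnion_subset fun n => cylinderInterior_subset n O).antisymm fun g hg => ?_
  obtain ⟨n, -, hn⟩ := (nhds_hasBasis g).mem_iff.1 (hO.mem_nhds hg)
  exact Set.mem_iUnion.2 ⟨n, fun h H => hn H⟩

/-! ### Measurability of the geometric graph -/

section

variable {X : Type u} [MetricSpace X] [MeasurableSpace X] [ProperSpace X] [BorelSpace X]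

omit [MeasurableSpace X] [ProperSpace X] [BorelSpace X] in
theorem isNearIsometry_subtype_val (x : X) (R : ℝ) {κ : ℝ} (hκ : 0 < κ) :
    IsNearIsometry (Subtype.val : closedBall x R → X) x κ where
  dist_le a b := le_mul_of_one_le_left dist_nonneg (by linarith)
  le_dist a b := le_mul_of_one_le_left dist_nonneg (by linarith)
  center _ := by simpa using hκ

theorem measurableSet_geomGraph_mem_cylinderInterior {Ω : Type v} [MeasurableSpace Ω] {x : X}
    {M : Ω → AtomicMeasure X} (hM : Measurable M)
    (hsimple : ∀ ω, ∀ y, (M ω : Measure X) {y} ≤ 1) (hroot : ∀ ω, (M ω : Measure X) {x} = 0)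
    {L : ℝ} (hL : 0 < L) (n : ℕ) (O : Set RootedGraphClass.{u}) :
    MeasurableSet {ω | geomGraph x (M ω) L ∈ RootedGraphClass.cylinderInterior n O} := by
  -- One radius, hence one test family, for all levels l ≤ L + 1.
  set s : ℝ := n * (L + 1) + 1 with hs
  obtain ⟨φ, hφ⟩ := exists_isTestFamily x (lt_add_one s)
  let T : Ω → ℕ → ℝ := fun ω k => ballIntegral x (s + 1) Subtype.val (M ω) (φ k)
  have hT : Measurable T := measurable_pi_lambda _ fun k =>
    (measurable_ballIntegral x (s + 1) continuous_subtype_val (hφ.continuous k)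
      (hφ.nonneg k)).comp hM
  let l : ℕ → ℝ := fun i => L + 1 / (i + 1)
  have hl0 : ∀ i : ℕ, (0 : ℝ) < 1 / (i + 1) := fun i => by positivity
  have hl : Tendsto l atTop (𝓝[>] L) := by
    refine tendsto_nhdsWithin_iff.2 ⟨?_, .of_forall fun i => ?_⟩
    · simpa only [add_zero] using tendsto_const_nhds (x := L) |>.add
        (tendsto_one_div_add_atTop_nhds_zero_nat (𝕜 := ℝ))
    · exact lt_add_of_pos_right L (hl0 i)
  let E : ℕ → Set Ω := fun i =>
    {ω | geomGraph x (M ω) (l i) ∈ RootedGraphClass.cylinderInterior n O}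
  -- Measurability of `E i` is not known, so it is replaced by the largest open condition on the
  -- test integrals implying it. A configuration of `E i` for which l i is generic satisfies this
  -- condition.
  let U : ℕ → Set (ℕ → ℝ) := fun i => ⋃₀ {U | IsOpen U ∧ T ⁻¹' U ⊆ E i}
  have hUopen : ∀ i, IsOpen (U i) := fun i => isOpen_sUnion fun _ hV => hV.1
  have hUE : ∀ i ω, T ω ∈ U i → ω ∈ E i := by
    rintro i ω ⟨V, hV, hωV⟩
    exact hV.2 hωV
  have hnL : n * L < s := by
    rw [hs]
    linarith [(by positivity : (0 : ℝ) ≤ n)]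
  have hiff : {ω | geomGraph x (M ω) L ∈ RootedGraphClass.cylinderInterior n O} =
      {ω | ∀ᶠ i in atTop, T ω ∈ U i} := by
    ext ω
    have hev := hl.eventually (eventually_truncate_geomGraph_eq x (M ω) hL.le n hnL)
    constructor
    · intro hω
      filter_upwards [hev] with i hi
      have hli : l i ≤ L + 1 := by
        have : (1 : ℝ) / (i + 1) ≤ 1 := div_le_one_of_le₀ (by simp) (by positivity)
        simp only [l]
        linarith
      have hnl : n * l i < s := by
        have : n * l i ≤ n * (L + 1) := by gcongr
        linarith
      have hli0 : 0 < l i := hL.trans (lt_add_of_pos_right L (hl0 i))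
      obtain ⟨κ, hκ, j, h⟩ := exists_forall_truncate_geomGraph_eq hφ hli0 hnl (lt_add_one s)
        (hsimple ω) (hroot ω) fun a b ha hb => hi.2 a b
          ((dist_le_of_mem_reachWithin ha hli0.le).trans hnl.le) hb
      refine ⟨{t | ∀ k < j, |t k - T ω k| < κ}, ⟨?_, fun ω₁ hω₁ => ?_⟩, fun k _ => by simpa using hκ⟩
      · have : {t : ℕ → ℝ | ∀ k < j, |t k - T ω k| < κ} =
            ⋂ k ∈ Set.Iio j, {t | |t k - T ω k| < κ} := by
          ext t
          simp
        rw [this]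
        exact (Set.finite_Iio j).isOpen_biInter fun k _ =>
          isOpen_lt (by fun_prop) continuous_const
      · have h1 := h X x (M ω₁) Subtype.val (isNearIsometry_subtype_val x _ hκ) hω₁
        exact (RootedGraphClass.mem_cylinderInterior_congr (hi.1.symm.trans h1)).1 hω
    · intro hω
      obtain ⟨i, hi, hi'⟩ := (hev.and hω).exists
      exact (RootedGraphClass.mem_cylinderInterior_congr hi.1).1 (hUE i ω hi')
  rw [hiff]
  simp only [eventually_atTop, Set.ofPred_exists, Set.ofPred_forall]
  exact .iUnion fun i => .iInter fun k => .iInter fun _ => hT (hUopen k).measurableSet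

theorem IsSimplePointProcess.aemeasurable_geomGraph {Ω : Type v} [MeasurableSpace Ω]
    {P : Measure Ω} {x : X} {M : Ω → AtomicMeasure X} (hM : IsSimplePointProcess P x M) {L : ℝ}
    (hL : 0 < L) : AEMeasurable (fun ω => geomGraph x (M ω) L) P := by
  obtain ⟨B, hB, hBm, hB0⟩ := exists_measurable_superset_of_null
    (ae_iff.1 (hM.simple.and hM.root_notMem))
  have hgood : ∀ ω : ↑Bᶜ, (∀ y, (M ω : Measure X) {y} ≤ 1) ∧ (M ω : Measure X) {x} = 0 :=
    fun ω => by
      by_contra hcon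
      exact ω.2 (hB hcon)
  rw [← Measure.restrict_eq_self_of_ae_mem (compl_mem_ae_iff.2 hB0 : ∀ᵐ ω ∂P, ω ∈ Bᶜ)]
  refine aemeasurable_restrict_of_measurable_subtype hBm.compl (measurable_of_isOpen fun O hO => ?_)
  rw [← RootedGraphClass.iUnion_cylinderInterior hO, Set.preimage_iUnion]
  exact .iUnion fun n => measurableSet_geomGraph_mem_cylinderInterior
    (hM.measurable.comp measurable_subtype_coe) (fun ω => (hgood ω).1) (fun ω => (hgood ω).2) hL n O

end

/-! ### Convergence of the geometric graphs -/

theorem measure_cylinderInterior_le_liminf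
    {X : ℕ → Type u} [∀ N, MetricSpace (X N)] [∀ N, ProperSpace (X N)]
    [∀ N, MeasurableSpace (X N)] [∀ N, BorelSpace (X N)] {x : ∀ N, X N}
    {Ω : ℕ → Type v} [∀ N, MeasurableSpace (Ω N)] {P : ∀ N, Measure (Ω N)}
    [∀ N, IsProbabilityMeasure (P N)] {M : ∀ N, Ω N → AtomicMeasure (X N)}
    (hM : ∀ N, Measurable (M N))
    {X' : Type u} [MetricSpace X'] [ProperSpace X'] [MeasurableSpace X'] [BorelSpace X'] {x' : X'}
    {Ω' : Type w} [MeasurableSpace Ω'] {P' : Measure Ω'} [IsProbabilityMeasure P']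
    {M' : Ω' → AtomicMeasure X'} (hM' : IsSimplePointProcess P' x' M')
    (hconv : RandomPointedLipschitzTendsto x P M x' P' M')
    {L : ℝ} (hL : 0 < L) (hreg : ∀ᵐ ω ∂P', ContinuousAt (fun l : ℝ => geomGraph x' (M' ω) l) L)
    (n : ℕ) (O : Set RootedGraphClass.{u}) :
    P' {ω | geomGraph x' (M' ω) L ∈ RootedGraphClass.cylinderInterior n O} ≤
      liminf (fun N => P N {ω | geomGraph (x N) (M N ω) L ∈ O}) atTop := by
  set s : ℝ := n * L + 1
  have hR : 0 < s + 1 := by positivity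
  obtain ⟨φ, hφ⟩ := exists_isTestFamily x' (lt_add_one s)
  obtain ⟨N₀, f, hf, hlaw⟩ := hconv (s + 1) hR
  -- The homeomorphisms exist only from N₀ on; the shift does not change the liminf.
  let ι : ℕ → Set.Ici N₀ := fun N => ⟨N + N₀, Nat.le_add_left _ _⟩
  have hι : Tendsto ι atTop atTop :=
    tendsto_atTop_atTop.2 fun b => ⟨b, fun N hN => hN.trans (Nat.le_add_right N N₀)⟩
  have hlimit : ∀ (ψ : X' → ℝ) ω,
      ∫ y in closedBall x' (s + 1), ψ y ∂(M' ω : Measure X') =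
        ballIntegral x' (s + 1) Subtype.val (M' ω) ψ := fun ψ ω =>
    (integral_subtype_comap isClosed_closedBall.measurableSet ψ).symm
  let F : ∀ N, closedBall (x (N + N₀)) (s + 1) → X' := fun N z => f (ι N) z
  have hF : ∀ N, Continuous (F N) := fun N => continuous_subtype_val.comp (f (ι N)).continuous
  let T : ∀ N, Ω (N + N₀) → ℕ → ℝ := fun N ω k =>
    ballIntegral (x (N + N₀)) (s + 1) (F N) (M (N + N₀) ω) (φ k)
  let T' : Ω' → ℕ → ℝ := fun ω k => ballIntegral x' (s + 1) Subtype.val (M' ω) (φ k)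
  have hT : ∀ N, Measurable (T N) := fun N => measurable_pi_lambda _ fun k =>
    (measurable_ballIntegral _ _ (hF N) (hφ.continuous k) (hφ.nonneg k)).comp (hM _)
  have hT' : Measurable T' := measurable_pi_lambda _ fun k =>
    (measurable_ballIntegral _ _ continuous_subtype_val (hφ.continuous k) (hφ.nonneg k)).comp
      hM'.measurable
  have hTlaw : ∀ (j : ℕ) (c : Fin j → ℝ), TendstoInDistribution
      (fun N ω => ∑ k, c k * T N ω k) atTop (fun ω => ∑ k, c k * T' ω k)
      (fun N => P (N + N₀)) P' := by
    intro j c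
    have hψ : Continuous fun y => ∑ k : Fin j, c k * φ k y :=
      continuous_finsetSum _ fun k _ => continuous_const.mul (hφ.continuous k)
    have hsupp : tsupport (fun y => ∑ k : Fin j, c k * φ k y) ⊆ closedBall x' (s + 1) := by
      refine closure_minimal (fun y hy => ?_) isClosed_closedBall
      obtain ⟨k, -, hk⟩ := Finset.exists_ne_zero_of_sum_ne_zero hy
      exact hφ.tsupport_subset k (subset_tsupport _ (right_ne_zero_of_mul hk))
    have h := hlaw _ hψ hsupp
    have h1 : ∀ N ω, ∑ k : Fin j, c k * T N ω k = ballIntegral (x (N + N₀)) (s + 1) (F N)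
        (M (N + N₀) ω) fun y => ∑ k : Fin j, c k * φ k y := fun N ω =>
      (ballIntegral_sum _ _ (hF N) _ _ _ fun k : Fin j => hφ.continuous k).symm
    have h2 : ∀ ω, ∑ k : Fin j, c k * T' ω k = ballIntegral x' (s + 1) Subtype.val (M' ω)
        fun y => ∑ k : Fin j, c k * φ k y := fun ω =>
      (ballIntegral_sum _ _ continuous_subtype_val _ _ _ fun k : Fin j => hφ.continuous k).symm
    simp only [h1, h2, ← hlimit]
    exact ⟨fun N => h.forall_aemeasurable (ι N), h.aemeasurable_limit, h.tendsto.comp hι⟩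
  rw [← liminf_nat_add _ N₀]
  refine measure_le_liminf_of_locally_determined hT hT' hTlaw ?_
  filter_upwards [hM'.simple, hM'.root_notMem, hreg] with ω h1 h2 h3 hω
  -- Regularity enters here, through continuity of the graph at level L.
  obtain ⟨κ, hκ, j, h⟩ := exists_forall_truncate_geomGraph_eq hφ hL (lt_add_one _) (lt_add_one s)
    h1 h2 fun a b ha _ =>
      dist_ne_of_continuousAt_geomGraph hL h3 (SimpleGraph.reachable_of_mem_reachWithin ha)
  obtain ⟨ε, hε, hiso⟩ := exists_isNearIsometry_of_pointedDistortion_lt (x := x') hR hκ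
  obtain ⟨N₁, hN₁⟩ := eventually_atTop.1 ((hf.comp hι).eventually (gt_mem_nhds hε))
  refine ⟨κ, hκ, j, N₁, fun N hN ω₁ hω₁ => ?_⟩
  refine RootedGraphClass.cylinderInterior_subset n O ?_
  rwa [← RootedGraphClass.mem_cylinderInterior_congr
    (h _ _ _ (F N) (hiso _ _ _ (hN₁ N hN)) hω₁)]

theorem theorem4p8
    {X : ℕ → Type u} [∀ N, MetricSpace (X N)] [∀ N, ProperSpace (X N)]
    [∀ N, MeasurableSpace (X N)] [∀ N, BorelSpace (X N)] (x : ∀ N, X N)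
    {Ω : ℕ → Type v} [∀ N, MeasurableSpace (Ω N)] (P : ∀ N, Measure (Ω N))
    [∀ N, IsProbabilityMeasure (P N)] (M : ∀ N, Ω N → AtomicMeasure (X N))
    (hM : ∀ N, IsSimplePointProcess (P N) (x N) (M N))
    {X' : Type u} [MetricSpace X'] [ProperSpace X'] [MeasurableSpace X'] [BorelSpace X'] (x' : X')
    {Ω' : Type w} [MeasurableSpace Ω'] (P' : Measure Ω') [IsProbabilityMeasure P']
    (M' : Ω' → AtomicMeasure X') (hM' : IsSimplePointProcess P' x' M')
    (hconv : RandomPointedLipschitzTendsto x P M x' P' M')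
    (hreg : IsRegularPointProcess P' x' M')
    (L : ℝ) (hL : 0 < L) :
    TendstoInDistribution (fun (N : ℕ) (ω : Ω N) => geomGraph (x N) (M N ω) L) atTop
      (fun ω : Ω' => geomGraph x' (M' ω) L) P P' := by
  have hmeas := fun N => (hM N).aemeasurable_geomGraph hL
  have hmeas' := hM'.aemeasurable_geomGraph hL
  refine ⟨hmeas, hmeas', tendsto_of_forall_isOpen_le_liminf' fun O hO => ?_⟩
  simp only [ProbabilityMeasure.coe_mk]
  rw [Measure.map_apply_of_aemeasurable hmeas' hO.measurableSet]
  simp only [Measure.map_apply_of_aemeasurable (hmeas _) hO.measurableSet]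
  rw [← RootedGraphClass.iUnion_cylinderInterior hO, Set.preimage_iUnion,
    RootedGraphClass.iUnion_cylinderInterior hO, Monotone.measure_iUnion]
  · exact iSup_le fun n => measure_cylinderInterior_le_liminf (fun N => (hM N).measurable) hM'
      hconv hL (hreg L hL) n O
  · exact fun m n hmn => Set.preimage_mono (RootedGraphClass.cylinderInterior_mono O hmn)
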